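/- \textbf{Setting.} Let $n,p\ge 1$ be integers and $[p]=\{1,\dots,p\}$. Let $\mathcal H$ be a real reproducing kernel Hilbert space of square-integrable functions on $[0,1]$ with integral zero, whose kernel has the expansion $K(x,y)=\sum_{k\ge1}\mu_k\psi_k(x)\psi_k(y)$ for all $x,y\in[0,1]$, where $(\psi_k)_{k\ge1}$ is orthonormal in $L^2([0,1])$ and orthogonal to the constants and $1=\mu_1\ge\mu_2\ge\dots\ge0$. For $1\le s\le p$ let $\mathcal F_s$ be the set of functions $f(x)=\sum_{j\in S}f_j(x_j)$ on $[0,1]^p$ with $S\subset[p]$, $|S|\le s$, $f_j\in\mathcal H$ and $\|f_j\|_{\mathcal H}\le1$. Under $P_f$ one observes the Gaussian white noise model $dY_x=f(x)\,dx+n^{-1/2}\,dB_x$ on $[0,1]^p$. Put $X_{k,j}=\int_{[0,1]^p}\psi_k(x_j)\,dY_x$ for $k\ge 1$, $j\in[p]$. \textbf{Definitions.} For $a>0$ and $s\in[p]$ let $\nu_{\mathcal H}(s,a)$ be the smallest positive integer $\nu$ with $\mu_\nu\le \frac1n\sqrt{\nu\log(1+pa/s^2)}$. Let $$\mathscr V_a=\{2^k: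 k\in\{0,1,2,\dots\},\ 2^{k-1}<\nu_{\mathcal H}(s,a)\le2^k\text{ for some }s\in[p]\},$$ $$\mathscr A=\mathscr A_{\mathcal H}=\sup\{a\ge1:\log(e|\mathscr V_a|)\ge a\},\qquad \mathscr V_{\mathcal H}=\mathscr V_{\mathscr A},\qquad \mathscr S=\{1,2,4,\dots,2^{\lceil\log_2\sqrt{p\mathscr A}\rceil-1}\}\cup\{p\}.$$ Write $L_s=\log(1+p\mathscr A/s^2)$ and $$\tau_{\mathrm{adapt}}^2(p,s,n)=\begin{cases}\frac snL_s\vee\frac sn\sqrt{\nu_{\mathcal H}(s,\mathscr A)L_s}&\text{if }s<\sqrt{p\mathscr A},\\ \frac sn\sqrt{\nu_{\mathcal H}(s,\mathscr A)L_s}&\text{if }s\ge\sqrt{p\mathscr A}.\end{cases}$$ For $d\in\mathbb N$ and $r\ge0$ let $E_j(d)=n\sum_{k\le d}X_{k,j}^2$ and $$T_r(d)=\sum_{j=1}^p(E_j(d)-\alpha_r(d))\mathbf 1_{\{E_j(d)\ge d+r^2\}},\qquad \alpha_r(d)=\frac{E(\|g\|^2\mathbf 1_{\{\|g\|^2\ge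 d+r^2\}})}{P\{\|g\|^2\ge d+r^2\}},\quad g\sim N(0,I_d).$$ Given constants $D,K_2,K_2',K_3,C>0$, set $d_\nu=\nu\vee\lceil D\rceil$, $r_{\nu,s}=K_2(d_\nu L_s)^{1/4}$, $r_s'=K_2'\sqrt{L_s}$ and $$\varphi_{\nu,s}=\begin{cases}\mathbf 1\{T_{r_{\nu,s}}(d_\nu)>Cs\sqrt{\nu L_s}\}&\text{if }s<\sqrt{p\mathscr A}\text{ and }\sqrt{L_s}\le K_3\sqrt{d_\nu},\\ \mathbf 1\{T_{r_s'}(d_\nu)>CsL_s\}&\text{if }s<\sqrt{p\mathscr A}\text{ and }\sqrt{L_s}>K_3\sqrt{d_\nu},\\ \mathbf 1\{n\sum_{j=1}^p\sum_{k\le\nu}X_{k,j}^2>\nu p+C\sqrt{\nu p\mathscr A}\}&\text{if }s\ge\sqrt{p\mathscr A}.\end{cases}$$ \textbf{Theorem.} There exist universal constants $D,K_2,K_2',K_3>0$ such that for every $\eta\in(0,1)$ there is $C_\eta>0$ depending only on $\eta$ such that, for all $C>C_\eta$ and for all $n,p,\mathcal H$ as above, $$P_0\Big\{\max_{\nu\in\mathscr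 V_{\mathcal H}}\max_{s\in\mathscr S}\varphi_{\nu,s}\ne0\Big\}+\max_{1\le s^*\le p}\ \sup_{\substack{f\in\mathcal F_{s^*}\\ \|f\|_2\ge C\tau_{\mathrm{adapt}}(p,s^*,n)}}P_f\Big\{\max_{\nu\in\mathscr V_{\mathcal H}}\max_{s\in\mathscr S}\varphi_{\nu,s}\ne1\Big\}\le\eta .$$ -/

import Mathlib

open MeasureTheory ProbabilityTheory
open scoped unitInterval ENNReal

noncomputable section

namespace SparseAdditive

/-! ### The function space, the parameter space and the observation model

Eigenvalues and eigenfunctions are indexed from `0`: `μ k` and `ψ k` stand for the `(k+1)`-st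
eigenvalue and eigenfunction. -/

/-- `(μ, ψ)` is the ordered eigensystem of the reproducing kernel Hilbert space `H` of centered
square-integrable functions on `[0,1]`, normalized so that the top eigenvalue is one: the `ψ k`
are orthonormal in `L²([0,1])`, orthogonal to the constants, and the kernel of `H` is
`K(x, y) = ∑ₖ μ k * ψ k x * ψ k y`. -/
structure IsEigensystem (H : Type*) [NormedAddCommGroup H] [InnerProductSpace ℝ H]
    [CompleteSpace H] [RKHS ℝ H I ℝ] (μ : ℕ → ℝ) (ψ : ℕ → I → ℝ) : Prop where
  memLp_coe : ∀ f : H, MemLp (fun x => f x) 2 (volume : Measure I)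
  integral_coe : ∀ f : H, ∫ x, f x = 0
  memLp : ∀ k, MemLp (ψ k) 2 (volume : Measure I)
  orthonormal : ∀ k l, ∫ x, ψ k x * ψ l x = if k = l then 1 else 0
  integral_eq_zero : ∀ k, ∫ x, ψ k x = 0
  nonneg : ∀ k, 0 ≤ μ k
  antitone : Antitone μ
  top_eq_one : μ 0 = 1
  kernel_expansion : ∀ x y, HasSum (fun k => μ k * ψ k x * ψ k y) (RKHS.kernel H x y 1)

/-- The class `𝓕ₛ` of sparse additive signals `f(x) = ∑_{j ∈ S} fⱼ(xⱼ)` with `|S| ≤ s` and each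
`fⱼ` in the unit ball of `H`. -/
def sparseClass (H : Type*) [NormedAddCommGroup H] [InnerProductSpace ℝ H]
    [RKHS ℝ H I ℝ] (p s : ℕ) : Set ((Fin p → I) → ℝ) :=
  {f | ∃ S : Finset (Fin p), S.card ≤ s ∧ ∃ g : Fin p → H,
    (∀ j ∈ S, ‖g j‖ ≤ 1) ∧ f = fun x => ∑ j ∈ S, g j (x j)}

/-- Under `P`, the process `Y` is an observation of the Gaussian white noise model
`dYₓ = f(x) dx + n^{-1/2} dBₓ` on `[0,1]ᵖ`: writing `Y g` for `∫ g dY`, the process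
`(Y g)_{g ∈ L²}` is Gaussian with means `⟨f, g⟩` and covariances `⟨g, h⟩ / n`. -/
structure IsWhiteNoise {Ω : Type*} [MeasurableSpace Ω] {p : ℕ} (n : ℕ) (f : (Fin p → I) → ℝ)
    (P : Measure Ω) (Y : ((Fin p → I) → ℝ) → Ω → ℝ) : Prop where
  gaussian : IsGaussianProcess
    (fun g : {g : (Fin p → I) → ℝ // MemLp g 2 (volume : Measure (Fin p → I))} => Y g.1) P
  mean : ∀ g, MemLp g 2 (volume : Measure (Fin p → I)) → ∫ ω, Y g ω ∂P = ∫ x, f x * g x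
  covariance : ∀ g h, MemLp g 2 (volume : Measure (Fin p → I)) →
    MemLp h 2 (volume : Measure (Fin p → I)) → cov[Y g, Y h; P] = (∫ x, g x * h x) / n

/-- The data `X_{k,j} = ∫ φ_{j,k} dY` with `φ_{j,k}(t) = ψ k (tⱼ)`. -/
def seqData {Ω : Type*} {p : ℕ} (ψ : ℕ → I → ℝ) (Y : ((Fin p → I) → ℝ) → Ω → ℝ) (ω : Ω)
    (k : ℕ) (j : Fin p) : ℝ :=
  Y (fun t => ψ k (t j)) ω

/-! ### Truncation levels, adaptation cost, grids and the adaptive rate -/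

/-- `log (1 + p a / s²)`. -/
def logTerm (p : ℕ) (a : ℝ) (s : ℕ) : ℝ := Real.log (1 + p * a / (s : ℝ) ^ 2)

/-- `ν_H(s, a)`: the smallest positive integer `ν` whose `ν`-th eigenvalue is at most
`√(ν log(1 + p a / s²)) / n`. -/
def nuH (μ : ℕ → ℝ) (n p : ℕ) (s : ℕ) (a : ℝ) : ℕ :=
  sInf {ν : ℕ | 1 ≤ ν ∧ μ (ν - 1) ≤ √(ν * logTerm p a s) / n}

/-- The grid `V_a`: all `2^k`, `k ≥ 0`, with `2^(k-1) < ν_H(s, a) ≤ 2^k` for some `s ∈ [p]`. -/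
def gridVa (μ : ℕ → ℝ) (n p : ℕ) (a : ℝ) : Set ℕ :=
  {m | ∃ k : ℕ, m = 2 ^ k ∧ ∃ s ∈ Set.Icc 1 p,
    (2 : ℝ) ^ ((k : ℤ) - 1) < nuH μ n p s a ∧ nuH μ n p s a ≤ 2 ^ k}

/-- The adaptation cost `A_H = sup {a ≥ 1 : log (e |V_a|) ≥ a}`. -/
def costA (μ : ℕ → ℝ) (n p : ℕ) : ℝ :=
  sSup {a : ℝ | 1 ≤ a ∧ a ≤ Real.log (Real.exp 1 * (gridVa μ n p a).ncard)}

/-- The grid of truncation levels `V_H = V_{A_H}`. -/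
def gridV (μ : ℕ → ℝ) (n p : ℕ) : Set ℕ := gridVa μ n p (costA μ n p)

/-- The grid of sparsities `{1, 2, 4, …, 2^(⌈log₂ √(p A_H)⌉ - 1)} ∪ {p}`. -/
def gridS (μ : ℕ → ℝ) (n p : ℕ) : Set ℕ :=
  {s | ∃ k : ℕ, (k : ℤ) ≤ ⌈Real.logb 2 √(p * costA μ n p)⌉ - 1 ∧ s = 2 ^ k} ∪ {p}

/-- The squared adaptive separation rate. -/
def tauSq (μ : ℕ → ℝ) (n p s : ℕ) : ℝ :=
  if (s : ℝ) < √(p * costA μ n p) then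
    max ((s : ℝ) / n * logTerm p (costA μ n p) s)
      ((s : ℝ) / n * √(nuH μ n p s (costA μ n p) * logTerm p (costA μ n p) s))
  else (s : ℝ) / n * √(nuH μ n p s (costA μ n p) * logTerm p (costA μ n p) s)

/-- The adaptive separation rate `τ_adapt(p, s, n)`. -/
def tau (μ : ℕ → ℝ) (n p s : ℕ) : ℝ := √(tauSq μ n p s)

/-! ### The test statistics and the adaptive test -/

/-- `α_r(d) = E[‖g‖² 1{‖g‖² ≥ d + r²}] / P{‖g‖² ≥ d + r²}` for `g ∼ N(0, I_d)`. -/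
def alpha (r : ℝ) (d : ℕ) : ℝ :=
  (∫ g in {g : Fin d → ℝ | d + r ^ 2 ≤ ∑ i, g i ^ 2}, ∑ i, g i ^ 2
      ∂Measure.pi (fun _ => gaussianReal 0 1)) /
    (Measure.pi (fun _ : Fin d => gaussianReal 0 1)).real {g | d + r ^ 2 ≤ ∑ i, g i ^ 2}

/-- `E_j(d) = n ∑_{k ≤ d} X_{k,j}²`. -/
def energy {p : ℕ} (n : ℕ) (X : ℕ → Fin p → ℝ) (d : ℕ) (j : Fin p) : ℝ :=
  n * ∑ k ∈ Finset.range d, X k j ^ 2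

/-- `T_r(d) = ∑_j (E_j(d) - α_r(d)) 1{E_j(d) ≥ d + r²}`. -/
def thresholdStat {p : ℕ} (n : ℕ) (X : ℕ → Fin p → ℝ) (r : ℝ) (d : ℕ) : ℝ :=
  ∑ j, if d + r ^ 2 ≤ energy n X d j then energy n X d j - alpha r d else 0

/-- `d_ν = max ν ⌈D⌉`. -/
def dLevel (D : ℝ) (ν : ℕ) : ℕ := max ν ⌈D⌉₊

/-- The bulk threshold `r_{ν,s} = K₂ (d_ν log(1 + p A_H / s²))^{1/4}`. -/
def rBulk (μ : ℕ → ℝ) (n p : ℕ) (D K₂ : ℝ) (ν s : ℕ) : ℝ :=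
  K₂ * (dLevel D ν * logTerm p (costA μ n p) s) ^ (1 / 4 : ℝ)

/-- The tail threshold `r'_s = K₂' √(log(1 + p A_H / s²))`. -/
def rTail (μ : ℕ → ℝ) (n p : ℕ) (K₂' : ℝ) (s : ℕ) : ℝ :=
  K₂' * √(logTerm p (costA μ n p) s)

open Classical in
/-- The `{0,1}`-valued test `φ_{ν,s}` evaluated at the data `X`. -/
def phi (μ : ℕ → ℝ) (n p : ℕ) (D K₂ K₂' K₃ C : ℝ) (X : ℕ → Fin p → ℝ) (ν s : ℕ) : ℕ :=
  if (s : ℝ) < √(p * costA μ n p) then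
    if √(logTerm p (costA μ n p) s) ≤ K₃ * √(dLevel D ν) then
      if C * s * √(ν * logTerm p (costA μ n p) s)
          < thresholdStat n X (rBulk μ n p D K₂ ν s) (dLevel D ν) then 1 else 0
    else
      if C * s * logTerm p (costA μ n p) s
          < thresholdStat n X (rTail μ n p K₂' s) (dLevel D ν) then 1 else 0
  else
    if ν * p + C * √(ν * p * costA μ n p)
        < n * ∑ j, ∑ k ∈ Finset.range ν, X k j ^ 2 then 1 else 0

open Classical in
/-- The adaptive test `max_{ν ∈ V_H} max_{s ∈ S} φ_{ν,s}`; as the `φ_{ν,s}` are `{0,1}`-valued,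
the maximum is `1` exactly when some `φ_{ν,s}` is `1`. -/
def scanTest (μ : ℕ → ℝ) (n p : ℕ) (D K₂ K₂' K₃ C : ℝ) (X : ℕ → Fin p → ℝ) : ℕ :=
  if ∃ ν ∈ gridV μ n p, ∃ s ∈ gridS μ n p, phi μ n p D K₂ K₂' K₃ C X ν s = 1 then 1 else 0

end SparseAdditive

end

/-! Write `A` for the adaptation cost, `L` for `logTerm p A s` and `q = max (√(νL)) L`. With the
constants `1, 3, 3, 1` for `D, K₂, K₂', K₃`, the bulk and tail tests become one test: threshold the
energy of each coordinate at `ν + 9q` and compare the sum with `C s q` (`phi_eq_one_iff_sparse`).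

Under the null hypothesis, a chi-square variable conditioned to exceed its threshold has exponential
tails. The thresholded, conditionally centered energy therefore has a Bernstein-type moment
generating function whose variance proxy is proportional to the exceedance probability
(`integral_exp_thresh_le`), and that probability is at most `exp (-L) ≤ s² / (pA)`. Chernoff's bound
then gives error `exp (-t (A + L))` (`measure_sum_thresh_noise_le`). The factor in `A` pays for the
at most `exp (A - 1)` truncation levels (`ncard_gridV_le`), and the factor in `L` pays for the
dyadic sparsities, because the numbers `exp (-L)` sum geometrically. The dense test is a plain
chi-square test at level `exp (-tA)`.

Under the alternative, cutting off at `ν ≥ ν_H` loses squared norm at most `s μ_ν ≤ τ²`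
(`integral_sq_sub_le`), so the captured energy is at least `(C² - 1) n τ²` (`signal_energy_ge`).
Chebyshev's inequality shows that at least half of it is visible. In the sparse regime thresholding
costs at most `21q` per signal coordinate, and the lower deviation of the noise coordinates is again
of order `C s q`. An energy of order `C² s q` beats both. In the dense regime the same energy
exceeds `C √(νpA)`, because `log (1 + x)` is comparable to `x` for `x ≤ 1`. -/

namespace SparseAdditive

/-! ### Tails of the chi-square distribution -/

/-- A product of densities is the density of the product measure. -/
theorem pi_withDensity {ι α : Type*} [Fintype ι] [MeasurableSpace α] (μ : Measure α)
    [IsProbabilityMeasure μ] {h : α → ℝ≥0∞} (hh : Measurable h) [SigmaFinite (μ.withDensity h)] :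
    Measure.pi (fun _ : ι => μ.withDensity h)
      = (Measure.pi fun _ : ι => μ).withDensity (fun x => ∏ i, h (x i)) := by
  refine Measure.pi_eq fun s hs => ?_
  rw [withDensity_apply _ (MeasurableSet.univ_pi hs), ← lintegral_indicator (MeasurableSet.univ_pi hs)]
  have h1 : ∀ x : ι → α, (Set.univ.pi s).indicator (fun x => ∏ i, h (x i)) x
      = ∏ i, (s i).indicator h (x i) := by
    intro x
    by_cases hx : x ∈ Set.univ.pi s
    · rw [Set.indicator_of_mem hx]
      exact Finset.prod_congr rfl fun i _ => (Set.indicator_of_mem (hx i trivial) _).symm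
    · rw [Set.indicator_of_notMem hx]
      simp only [Set.mem_pi, Set.mem_univ, true_implies, not_forall] at hx
      obtain ⟨i, hi⟩ := hx
      exact (Finset.prod_eq_zero (Finset.mem_univ i) (Set.indicator_of_notMem hi _)).symm
  simp_rw [h1]
  have hm : ∀ i, Measurable ((s i).indicator h) := fun i => hh.indicator (hs i)
  have hind : iIndepFun (fun i (x : ι → α) => (s i).indicator h (x i))
      (Measure.pi fun _ : ι => μ) := iIndepFun_pi fun i => (hm i).aemeasurable
  rw [lintegral_prod_eq_prod_lintegral_of_indepFun _ _ hind
    fun i => (hm i).comp (measurable_pi_apply i)]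
  refine Finset.prod_congr rfl fun i _ => ?_
  rw [withDensity_apply _ (hs i), ← lintegral_indicator (hs i),
    ← (measurePreserving_eval (fun _ : ι => μ) i).lintegral_comp (hm i)]

/-- The right-hand weight is the quotient of the densities of variance `c⁻²` and variance `1`. -/
theorem gaussianReal_map_inv_mul {c : ℝ} (hc : 0 < c) :
    (gaussianReal 0 1).map (c⁻¹ * ·) = (gaussianReal 0 1).withDensity
      (fun x => ENNReal.ofReal (c * Real.exp (-(c ^ 2 - 1) * x ^ 2 / 2))) := by
  have hv : (NNReal.mk (c⁻¹ ^ 2) (sq_nonneg _) * 1 : NNReal) ≠ 0 := by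
    rw [mul_one, ne_eq, ← NNReal.coe_inj]; simp [hc.ne']
  rw [gaussianReal_map_const_mul, mul_zero, gaussianReal_of_var_ne_zero _ hv,
    gaussianReal_of_var_ne_zero _ one_ne_zero, ← withDensity_mul _ (measurable_gaussianPDF _ _)
      (by fun_prop)]
  congr 1
  ext x
  rw [Pi.mul_apply, gaussianPDF, gaussianPDF, ← ENNReal.ofReal_mul (gaussianPDFReal_nonneg _ _ _)]
  congr 1
  simp only [gaussianPDFReal, sub_zero, mul_one, NNReal.coe_mk, NNReal.coe_one]
  have h1 : √(2 * Real.pi * c⁻¹ ^ 2) = √(2 * Real.pi) * c⁻¹ := by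
    rw [Real.sqrt_mul (by positivity), Real.sqrt_sq (by positivity)]
  rw [h1, mul_inv, inv_inv, mul_assoc, mul_assoc, mul_left_comm (Real.exp _) c, ← Real.exp_add]
  congr 3
  field_simp
  ring

/-- The standard Gaussian measure on `ι → ℝ`. -/
noncomputable abbrev stdGaussian (ι : Type*) [Fintype ι] : Measure (ι → ℝ) :=
  Measure.pi fun _ => gaussianReal 0 1

/-- The upper tail of the chi-square distribution. -/
noncomputable def chiTail (ι : Type*) [Fintype ι] (x : ℝ) : ℝ :=
  (stdGaussian ι).real {g | x ≤ ∑ i, g i ^ 2}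

section
variable {ι : Type*} [Fintype ι]

theorem measurableSet_le_sumSq (x : ℝ) : MeasurableSet {g : ι → ℝ | x ≤ ∑ i, g i ^ 2} :=
  measurableSet_le measurable_const (by fun_prop)

theorem stdGaussian_map_inv_smul {c : ℝ} (hc : 0 < c) :
    (stdGaussian ι).map (fun g i => c⁻¹ * g i) = (stdGaussian ι).withDensity
      (fun g => ∏ i, ENNReal.ofReal (c * Real.exp (-(c ^ 2 - 1) * g i ^ 2 / 2))) := by
  have : IsProbabilityMeasure ((gaussianReal 0 1).map (c⁻¹ * ·)) :=
    Measure.isProbabilityMeasure_map (by fun_prop)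
  rw [Measure.pi_map_pi (μ := fun _ : ι => gaussianReal 0 1) (f := fun _ x => c⁻¹ * x)
    (fun _ => by fun_prop)]
  rw [gaussianReal_map_inv_mul hc] at this ⊢
  exact pi_withDensity _ (by fun_prop)

/-- Rescaling by `c⁻¹` moves the threshold from `c² x` to `x` at the price of a likelihood ratio.
That ratio decreases in `‖g‖²`, so on the event it is largest at `‖g‖² = x`. All chi-square tail
bounds below come from this comparison. -/
theorem chiTail_mul_le {c : ℝ} (hc : 1 ≤ c) (x : ℝ) :
    chiTail ι (c ^ 2 * x)
      ≤ c ^ Fintype.card ι * Real.exp (-(c ^ 2 - 1) * x / 2) * chiTail ι x := by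
  have hc0 : 0 < c := by linarith
  have hset : {g : ι → ℝ | c ^ 2 * x ≤ ∑ i, g i ^ 2}
      = (fun g i => c⁻¹ * g i) ⁻¹' {g : ι → ℝ | x ≤ ∑ i, g i ^ 2} := by
    ext g
    simp only [Set.mem_ofPred_eq, Set.mem_preimage, mul_pow, ← Finset.mul_sum]
    rw [inv_pow, ← div_eq_inv_mul, le_div_iff₀' (by positivity)]
  have key : stdGaussian ι {g | c ^ 2 * x ≤ ∑ i, g i ^ 2}
      ≤ ENNReal.ofReal (c ^ Fintype.card ι * Real.exp (-(c ^ 2 - 1) * x / 2)) *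
        stdGaussian ι {g | x ≤ ∑ i, g i ^ 2} := by
    rw [hset, ← Measure.map_apply (by fun_prop) (measurableSet_le_sumSq x),
      stdGaussian_map_inv_smul hc0, withDensity_apply _ (measurableSet_le_sumSq x)]
    calc _ ≤ ∫⁻ _ in {g : ι → ℝ | x ≤ ∑ i, g i ^ 2},
          ENNReal.ofReal (c ^ Fintype.card ι * Real.exp (-(c ^ 2 - 1) * x / 2))
            ∂stdGaussian ι := by
          refine setLIntegral_mono' (measurableSet_le_sumSq x) fun g hg => ?_
          rw [← ENNReal.ofReal_prod_of_nonneg fun i _ => by positivity]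
          refine ENNReal.ofReal_le_ofReal ?_
          rw [Finset.prod_mul_distrib, Finset.prod_const, Finset.card_univ, ← Real.exp_sum]
          gcongr
          rw [← Finset.sum_div, ← Finset.mul_sum]
          have h1 : x ≤ ∑ i, g i ^ 2 := hg
          have h2 : 1 ≤ c ^ 2 := one_le_pow₀ hc
          nlinarith
      _ = _ := by rw [setLIntegral_const]
  unfold chiTail Measure.real
  rw [← ENNReal.toReal_ofReal (r := c ^ Fintype.card ι * Real.exp (-(c ^ 2 - 1) * x / 2))
    (by positivity), ← ENNReal.toReal_mul]
  exact ENNReal.toReal_mono (ENNReal.mul_ne_top ENNReal.ofReal_ne_top (measure_ne_top _ _)) key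

theorem chiTail_nonneg (x : ℝ) : 0 ≤ chiTail ι x := measureReal_nonneg

theorem chiTail_le_one (x : ℝ) : chiTail ι x ≤ 1 := measureReal_le_one

/-- Beyond `x`, the chi-square tail decays exponentially at rate `(1 - d / x) / 2`. -/
theorem chiTail_add_le {x y : ℝ} (hx : 0 < x) (hy : 0 ≤ y) :
    chiTail ι (x + y) ≤ Real.exp (-((x - Fintype.card ι) / (2 * x) * y)) * chiTail ι x := by
  set d := Fintype.card ι
  have hc0 : 0 ≤ 1 + y / x := by positivity
  have hc : 1 ≤ √(1 + y / x) := by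
    rw [Real.one_le_sqrt]; linarith [div_nonneg hy hx.le]
  have h := chiTail_mul_le (ι := ι) hc x
  rw [Real.sq_sqrt hc0] at h
  have e : (1 + y / x) * x = x + y := by field_simp
  rw [e] at h
  refine h.trans (mul_le_mul_of_nonneg_right ?_ (chiTail_nonneg x))
  -- With `c² = 1 + y / x`, the crude bound `1 + u ≤ exp u` already yields the linear rate.
  have h1 : √(1 + y / x) ≤ Real.exp (y / (2 * x)) := by
    rw [Real.sqrt_le_left (Real.exp_pos _).le, ← Real.exp_nat_mul]
    have := Real.add_one_le_exp (y / x)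
    have e2 : ((2 : ℕ) : ℝ) * (y / (2 * x)) = y / x := by push_cast; field_simp
    rw [e2]; linarith
  calc √(1 + y / x) ^ d * Real.exp (-(1 + y / x - 1) * x / 2)
      ≤ Real.exp (y / (2 * x)) ^ d * Real.exp (-(1 + y / x - 1) * x / 2) := by gcongr
    _ = Real.exp (-((x - d) / (2 * x) * y)) := by
      rw [← Real.exp_nat_mul, ← Real.exp_add]; congr 1; field_simp; ring

/-- This is `u ≤ sinh u` at `u = log w`. It is exact to second order at `w = 1`, which the quadratic
exponent near the mean requires. -/
theorem log_le_half_sub_inv {w : ℝ} (hw : 1 ≤ w) : Real.log w ≤ (w - w⁻¹) / 2 := by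
  have h := Real.self_le_sinh_iff.2 (Real.log_nonneg hw)
  rwa [Real.sinh_eq, Real.exp_neg, Real.exp_log (by linarith)] at h

theorem chiTail_card_add_le {y : ℝ} (hι : 0 < Fintype.card ι) (hy : 0 ≤ y) :
    chiTail ι (Fintype.card ι + y)
      ≤ Real.exp (-(y ^ 2 / (4 * (Fintype.card ι + y)))) := by
  set d := Fintype.card ι
  have hd : (0 : ℝ) < d := by exact_mod_cast hι
  have hw : 1 ≤ 1 + y / d := by linarith [div_nonneg hy hd.le]
  have hc : 1 ≤ √(1 + y / d) := by rwa [Real.one_le_sqrt]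
  have h := chiTail_mul_le (ι := ι) hc d
  rw [Real.sq_sqrt (by linarith)] at h
  have e : (1 + y / d) * d = d + y := by field_simp
  rw [e] at h
  refine h.trans ?_
  refine (mul_le_of_le_one_right (by positivity) (chiTail_le_one _)).trans ?_
  change √(1 + y / d) ^ d * _ ≤ _
  rw [← Real.exp_log (show 0 < √(1 + y / d) by linarith), ← Real.exp_nat_mul, ← Real.exp_add,
    Real.exp_le_exp, Real.log_sqrt (by linarith)]
  have h1 := log_le_half_sub_inv hw
  have h2 : (d : ℝ) * (Real.log (1 + y / d) / 2) ≤ d * (((1 + y / d) - (1 + y / d)⁻¹) / 2 / 2) := by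
    gcongr
  have h3 : d * (((1 + y / d) - (1 + y / d)⁻¹) / 2 / 2) + -(1 + y / d - 1) * d / 2
      = -(y ^ 2 / (4 * (d + y))) := by
    have : (d : ℝ) + y ≠ 0 := by positivity
    have h4 : 1 + y / d = (d + y) / d := by field_simp
    rw [h4]; field_simp; ring
  linarith

/-- The Laurent–Massart bound for the upper tail of the chi-square distribution, with a larger
constant. -/
theorem chiTail_le_exp_neg {x y : ℝ} (hι : 0 < Fintype.card ι) (hx : 0 ≤ x)
    (hy : 2 * √(Fintype.card ι * x) + 4 * x ≤ y) :
    chiTail ι (Fintype.card ι + y) ≤ Real.exp (-x) := by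
  have hd : (0 : ℝ) < Fintype.card ι := by exact_mod_cast hι
  have hs := Real.sqrt_nonneg (Fintype.card ι * x)
  have hs2 := Real.sq_sqrt (show 0 ≤ Fintype.card ι * x by positivity)
  have hy0 : 0 ≤ y := by linarith
  refine (chiTail_card_add_le hι hy0).trans (Real.exp_le_exp.2 (neg_le_neg ?_))
  rw [le_div_iff₀ (by positivity)]
  -- Multiplying the two lower bounds gives `y (y - 4x) ≥ 4dx`, which is `y² ≥ 4x (d + y)`.
  nlinarith [mul_le_mul (show 2 * √(Fintype.card ι * x) ≤ y by linarith)
    (show 2 * √(Fintype.card ι * x) ≤ y - 4 * x by linarith) (by positivity) hy0]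

theorem chiTail_pos [Nonempty ι] (x : ℝ) : 0 < chiTail ι x := by
  have : (gaussianReal 0 1).IsOpenPosMeasure :=
    (gaussianReal_absolutelyContinuous' 0 one_ne_zero).isOpenPosMeasure
  have hopen : IsOpen {g : ι → ℝ | x < ∑ i, g i ^ 2} :=
    isOpen_lt continuous_const (by fun_prop)
  obtain ⟨i⟩ := ‹Nonempty ι›
  have hne : {g : ι → ℝ | x < ∑ i, g i ^ 2}.Nonempty := by
    refine ⟨fun _ => |x| + 1, ?_⟩
    have h1 : (|x| + 1) ^ 2 ≤ ∑ _i : ι, (|x| + 1) ^ 2 :=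
      Finset.single_le_sum (f := fun _ : ι => (|x| + 1) ^ 2) (fun _ _ => sq_nonneg _)
        (Finset.mem_univ i)
    have := le_abs_self x
    have := abs_nonneg x
    simp only [Set.mem_ofPred_eq]
    nlinarith
  have h := hopen.measure_pos (stdGaussian ι) hne
  refine ENNReal.toReal_pos (h.trans_le (measure_mono fun g hg => ?_)).ne' (measure_ne_top _ _)
  exact (show x < ∑ i, g i ^ 2 from hg).le

end

/-! ### Thresholded chi-square variables -/

section
variable {ι : Type*} [Fintype ι]

/-- The exponential decay rate of the chi-square tail beyond `x`. -/
noncomputable def tailRate (ι : Type*) [Fintype ι] (x : ℝ) : ℝ :=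
  (x - Fintype.card ι) / (2 * x)

theorem tailRate_pos {x : ℝ} (hx : Fintype.card ι < x) : 0 < tailRate ι x := by
  have : (0 : ℝ) ≤ Fintype.card ι := Nat.cast_nonneg _
  exact div_pos (by linarith) (by linarith)

/-- Tilting by only half of the decay rate leaves the other half for integrability. -/
theorem chiTail_add_mul_le {x t : ℝ} (hx : Fintype.card ι < x) (ht : 0 ≤ t) :
    chiTail ι (x + t) * (tailRate ι x / 2 * Real.exp (tailRate ι x / 2 * t))
      ≤ chiTail ι x * (tailRate ι x / 2) * Real.exp (-(tailRate ι x / 2) * t) := by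
  have hl := tailRate_pos hx
  have hx0 : 0 < x := lt_of_le_of_lt (Nat.cast_nonneg _) hx
  have h2 : chiTail ι (x + t) ≤ Real.exp (-(tailRate ι x * t)) * chiTail ι x :=
    chiTail_add_le hx0 ht
  have e : Real.exp (-(tailRate ι x / 2) * t)
      = Real.exp (-(tailRate ι x * t)) * Real.exp (tailRate ι x / 2 * t) := by
    rw [← Real.exp_add]; congr 1; ring
  rw [e]
  calc _ ≤ (Real.exp (-(tailRate ι x * t)) * chiTail ι x) *
        (tailRate ι x / 2 * Real.exp (tailRate ι x / 2 * t)) :=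
        mul_le_mul_of_nonneg_right h2 (by positivity)
    _ = _ := by ring

theorem lintegral_excess_tail_le {x : ℝ} (hx : Fintype.card ι < x) :
    ∫⁻ t in Set.Ioi (0 : ℝ), (stdGaussian ι).restrict {g | x ≤ ∑ i, g i ^ 2}
        {g | t ≤ ∑ i, g i ^ 2 - x} *
      ENNReal.ofReal (tailRate ι x / 2 * Real.exp (tailRate ι x / 2 * t))
      ≤ ENNReal.ofReal (chiTail ι x) := by
  have hl := tailRate_pos hx
  have hp := chiTail_nonneg (ι := ι) x
  have hI : IntegrableOn (fun t => Real.exp (-(tailRate ι x / 2) * t)) (Set.Ioi 0) :=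
    integrableOn_exp_mul_Ioi (by linarith) 0
  calc _ ≤ ∫⁻ t in Set.Ioi (0 : ℝ), ENNReal.ofReal
        (chiTail ι x * (tailRate ι x / 2) * Real.exp (-(tailRate ι x / 2) * t)) := by
        refine setLIntegral_mono' measurableSet_Ioi fun t ht => ?_
        have h1 : (stdGaussian ι).restrict {g | x ≤ ∑ i, g i ^ 2} {g | t ≤ ∑ i, g i ^ 2 - x}
            ≤ ENNReal.ofReal (chiTail ι (x + t)) := by
          rw [chiTail, ofReal_measureReal]
          refine (Measure.restrict_apply_le _ _).trans (measure_mono fun g hg => ?_)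
          simp only [Set.mem_ofPred_eq] at hg ⊢
          linarith
        refine (mul_le_mul_left h1 _).trans ?_
        rw [← ENNReal.ofReal_mul (chiTail_nonneg _)]
        exact ENNReal.ofReal_le_ofReal (chiTail_add_mul_le hx (le_of_lt ht))
    _ = ENNReal.ofReal (chiTail ι x) := by
        rw [← ofReal_integral_eq_lintegral_ofReal (hI.const_mul _)
          (ae_of_all _ fun t => by positivity),
          integral_const_mul, integral_exp_mul_Ioi (by linarith)]
        congr 1
        field_simp
        simp

theorem integral_mul_exp_mul (l t : ℝ) :
    ∫ u in (0 : ℝ)..t, l * Real.exp (l * u) = Real.exp (l * t) - 1 := by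
  have hg : ∀ t : ℝ, HasDerivAt (fun t => Real.exp (l * t)) (l * Real.exp (l * t)) t := by
    intro t
    have := ((hasDerivAt_id t).const_mul l).exp
    simpa [mul_comm] using this
  rw [intervalIntegral.integral_eq_sub_of_hasDerivAt (fun u _ => hg u)
    (Continuous.intervalIntegrable (by fun_prop) _ _)]
  simp

theorem lintegral_exp_mul_layercake {α : Type*} [MeasurableSpace α] {μ : Measure α} {l : ℝ}
    (hl : 0 < l) {f : α → ℝ} (h0 : ∀ᵐ a ∂μ, (0 : ℝ) ≤ f a) (hf : AEMeasurable f μ) :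
    ∫⁻ a, ENNReal.ofReal (∫ t in (0 : ℝ)..f a, l / 2 * Real.exp (l / 2 * t)) ∂μ
      = ∫⁻ t in Set.Ioi (0 : ℝ), μ {a | t ≤ f a} *
        ENNReal.ofReal (l / 2 * Real.exp (l / 2 * t)) := by
  have hc : Continuous fun t => l / 2 * Real.exp (l / 2 * t) := by fun_prop
  exact lintegral_comp_eq_lintegral_meas_le_mul μ h0 hf (fun t _ => hc.intervalIntegrable _ _)
    (ae_of_all _ fun t => mul_nonneg (by linarith) (Real.exp_pos _).le)

/-- Layer-cake formula: the exponential is `1` plus the integral of its derivative. The `1`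
contributes the exceedance probability, and the integral contributes at most as much again. -/
theorem lintegral_exp_excess_le {x : ℝ} (hx : Fintype.card ι < x) :
    ∫⁻ g in {g : ι → ℝ | x ≤ ∑ i, g i ^ 2},
      ENNReal.ofReal (Real.exp (tailRate ι x / 2 * (∑ i, g i ^ 2 - x))) ∂stdGaussian ι
      ≤ ENNReal.ofReal (2 * chiTail ι x) := by
  have hl := tailRate_pos hx
  have hsm : MeasurableSet {g : ι → ℝ | x ≤ ∑ i, g i ^ 2} := measurableSet_le_sumSq x
  have hfm : Measurable fun g : ι → ℝ => ∑ i, g i ^ 2 - x := by fun_prop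
  have h0 : ∀ᵐ g ∂(stdGaussian ι).restrict {g : ι → ℝ | x ≤ ∑ i, g i ^ 2},
      (0 : ℝ) ≤ ∑ i, g i ^ 2 - x := by
    filter_upwards [ae_restrict_mem hsm] with g hg
    exact sub_nonneg.2 hg
  have hlc := lintegral_exp_mul_layercake hl h0 hfm.aemeasurable
  have hle : ∀ g ∈ {g : ι → ℝ | x ≤ ∑ i, g i ^ 2},
      ENNReal.ofReal (Real.exp (tailRate ι x / 2 * (∑ i, g i ^ 2 - x)))
      = ENNReal.ofReal (∫ u in (0 : ℝ)..(∑ i, g i ^ 2 - x),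
        tailRate ι x / 2 * Real.exp (tailRate ι x / 2 * u)) + 1 := by
    intro g hgs
    have h0 : 0 ≤ ∑ i, g i ^ 2 - x := sub_nonneg.2 hgs
    have h1 : 1 ≤ Real.exp (tailRate ι x / 2 * (∑ i, g i ^ 2 - x)) :=
      Real.one_le_exp (mul_nonneg (by linarith) h0)
    rw [integral_mul_exp_mul, ← ENNReal.ofReal_one,
      ← ENNReal.ofReal_add (sub_nonneg.2 h1) zero_le_one, sub_add_cancel]
  rw [setLIntegral_congr_fun hsm hle, lintegral_add_right _ measurable_const, hlc, two_mul,
    ENNReal.ofReal_add (chiTail_nonneg _) (chiTail_nonneg _)]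
  refine add_le_add (lintegral_excess_tail_le hx) ?_
  rw [setLIntegral_one, chiTail, ofReal_measureReal]

/-- The conditional mean of a chi-square variable given that it is at least `x`. -/
noncomputable def condMean (ι : Type*) [Fintype ι] (x : ℝ) : ℝ :=
  (∫ g in {g : ι → ℝ | x ≤ ∑ i, g i ^ 2}, ∑ i, g i ^ 2 ∂stdGaussian ι) / chiTail ι x

/-- The thresholded centered energy. -/
noncomputable def thresh (ι : Type*) [Fintype ι] (x e : ℝ) : ℝ :=
  if x ≤ e then e - condMean ι x else 0

theorem measurable_thresh (x : ℝ) : Measurable (thresh ι x) :=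
  Measurable.ite (measurableSet_le measurable_const measurable_id)
    (measurable_id.sub_const _) measurable_const

theorem integrableOn_exp_excess {x : ℝ} (hx : Fintype.card ι < x) :
    IntegrableOn (fun g : ι → ℝ => Real.exp (tailRate ι x / 2 * (∑ i, g i ^ 2 - x)))
      {g | x ≤ ∑ i, g i ^ 2} (stdGaussian ι) := by
  refine ⟨Continuous.aestronglyMeasurable (by fun_prop), ?_⟩
  rw [hasFiniteIntegral_iff_ofReal (ae_of_all _ fun _ => (Real.exp_pos _).le)]
  exact (lintegral_exp_excess_le hx).trans_lt ENNReal.ofReal_lt_top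

theorem integral_exp_excess_le {x : ℝ} (hx : Fintype.card ι < x) :
    ∫ g in {g : ι → ℝ | x ≤ ∑ i, g i ^ 2},
      Real.exp (tailRate ι x / 2 * (∑ i, g i ^ 2 - x)) ∂stdGaussian ι ≤ 2 * chiTail ι x := by
  rw [integral_eq_lintegral_of_nonneg_ae (ae_of_all _ fun _ => (Real.exp_pos _).le)
    (Continuous.aestronglyMeasurable (by fun_prop))]
  exact ENNReal.toReal_le_of_le_ofReal (mul_nonneg zero_le_two (chiTail_nonneg _))
    (lintegral_exp_excess_le hx)

theorem integrableOn_excess {x : ℝ} (hx : Fintype.card ι < x) :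
    IntegrableOn (fun g : ι → ℝ => ∑ i, g i ^ 2 - x)
      {g | x ≤ ∑ i, g i ^ 2} (stdGaussian ι) := by
  have hl := tailRate_pos hx
  refine ((integrableOn_exp_excess hx).const_mul (2 / tailRate ι x)).mono'
    (Continuous.aestronglyMeasurable (by fun_prop)) ?_
  refine (ae_restrict_iff' (measurableSet_le_sumSq x)).2 (ae_of_all _ fun g hg => ?_)
  have h0 : 0 ≤ ∑ i, g i ^ 2 - x := sub_nonneg.2 hg
  rw [Real.norm_of_nonneg h0, div_mul_eq_mul_div, le_div_iff₀ hl]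
  have := Real.add_one_le_exp (tailRate ι x / 2 * (∑ i, g i ^ 2 - x))
  linarith

theorem setIntegral_excess [Nonempty ι] {x : ℝ} (hx : Fintype.card ι < x) :
    ∫ g in {g : ι → ℝ | x ≤ ∑ i, g i ^ 2}, (∑ i, g i ^ 2 - x) ∂stdGaussian ι
      = (condMean ι x - x) * chiTail ι x := by
  have h1 : ∫ g in {g : ι → ℝ | x ≤ ∑ i, g i ^ 2}, ∑ i, g i ^ 2 ∂stdGaussian ι
      = condMean ι x * chiTail ι x := (div_mul_cancel₀ _ (chiTail_pos x).ne').symm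
  have h2 : IntegrableOn (fun g : ι → ℝ => ∑ i, g i ^ 2) {g | x ≤ ∑ i, g i ^ 2} (stdGaussian ι) := by
    have := (integrableOn_excess hx).add (integrableOn_const (μ := stdGaussian ι) (C := x)
      (s := {g : ι → ℝ | x ≤ ∑ i, g i ^ 2}) (measure_ne_top _ _))
    simpa [Pi.add_def] using this
  rw [integral_sub h2 (integrableOn_const (measure_ne_top _ _)), h1, setIntegral_const, sub_mul,
    smul_eq_mul, mul_comm x]
  rfl

theorem le_condMean [Nonempty ι] {x : ℝ} (hx : Fintype.card ι < x) : x ≤ condMean ι x := by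
  have h := setIntegral_excess hx
  have h1 : 0 ≤ (condMean ι x - x) * chiTail ι x := by
    rw [← h]
    exact setIntegral_nonneg (measurableSet_le_sumSq x) fun g hg => sub_nonneg.2 hg
  linarith [nonneg_of_mul_nonneg_left h1 (chiTail_pos x)]

/-- Apply `u + 1 ≤ exp u` inside the exponential moment of the excess, then cancel one copy of the
exceedance probability. -/
theorem tailRate_mul_condMean_sub_le [Nonempty ι] {x : ℝ} (hx : Fintype.card ι < x) :
    tailRate ι x / 2 * (condMean ι x - x) ≤ 1 := by
  have h := setIntegral_excess hx
  have h1 := integral_exp_excess_le hx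
  have h2 : ∫ g in {g : ι → ℝ | x ≤ ∑ i, g i ^ 2},
      (tailRate ι x / 2 * (∑ i, g i ^ 2 - x) + 1) ∂stdGaussian ι
      ≤ ∫ g in {g : ι → ℝ | x ≤ ∑ i, g i ^ 2},
      Real.exp (tailRate ι x / 2 * (∑ i, g i ^ 2 - x)) ∂stdGaussian ι :=
    integral_mono (((integrableOn_excess hx).const_mul _).add (integrable_const _))
      (integrableOn_exp_excess hx) fun g => Real.add_one_le_exp _
  rw [integral_add ((integrableOn_excess hx).const_mul _) (integrable_const _),
    integral_const_mul, h, integral_const, measureReal_restrict_apply_univ, smul_eq_mul,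
    mul_one] at h2
  have hp := chiTail_pos (ι := ι) x
  have h3 : (stdGaussian ι).real {g | x ≤ ∑ i, g i ^ 2} = chiTail ι x := rfl
  rw [h3] at h2
  refine le_of_mul_le_mul_right ?_ hp
  linarith

theorem exp_le_one_add_add_sq (x : ℝ) : Real.exp x ≤ 1 + x + x ^ 2 * Real.exp |x| := by
  have h := Complex.norm_exp_sub_sum_le_norm_mul_exp (x : ℂ) 2
  have e : Complex.exp (x : ℂ) - ∑ m ∈ Finset.range 2, (x : ℂ) ^ m / (m.factorial : ℂ)
      = ((Real.exp x - (1 + x) : ℝ) : ℂ) := by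
    simp [Finset.sum_range_succ]
  rw [e, Complex.norm_real, Complex.norm_real, Real.norm_eq_abs, Real.norm_eq_abs, sq_abs] at h
  linarith [(abs_le.1 h).2]

theorem sq_le_two_mul_exp {y : ℝ} (hy : 0 ≤ y) : y ^ 2 ≤ 2 * Real.exp y := by
  linarith [Real.quadratic_le_exp_of_nonneg hy]

/-- The second-order remainder vanishes below the threshold. This localization is what later makes
the variance proxy proportional to the exceedance probability. -/
theorem exp_mul_thresh_le [Nonempty ι] {x k : ℝ} (hx : Fintype.card ι < x) (hk : |k| ≤ 1 / 4)
    (g : ι → ℝ) :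
    Real.exp (k * tailRate ι x * thresh ι x (∑ i, g i ^ 2))
      ≤ 1 + k * tailRate ι x * thresh ι x (∑ i, g i ^ 2) +
        {g : ι → ℝ | x ≤ ∑ i, g i ^ 2}.indicator (fun g => 32 * Real.exp 1 * k ^ 2 *
          Real.exp (tailRate ι x / 2 * (∑ i, g i ^ 2 - x))) g := by
  by_cases hg : x ≤ ∑ i, g i ^ 2
  · rw [Set.indicator_of_mem (by exact hg), thresh, if_pos hg]
    set l := tailRate ι x
    set w := condMean ι x
    set e := ∑ i, g i ^ 2
    have hl : 0 < l := tailRate_pos hx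
    have hw1 : x ≤ w := le_condMean hx
    have hw2 : l / 2 * (w - x) ≤ 1 := tailRate_mul_condMean_sub_le hx
    refine (exp_le_one_add_add_sq _).trans (add_le_add_right ?_ _)
    -- The condition `|k| ≤ 1/4` makes `y` dominate the exponent. One factor `exp y` absorbs `y²`
    -- and another bounds the remainder. The product `exp (2y)` fits the available moment because
    -- the conditional mean is within `2 / l` of `x`.
    set y := l * |e - w| / 4 with hy
    have hy0 : 0 ≤ y := by positivity
    have h1 : |k * l * (e - w)| = |k| * (4 * y) := by
      rw [abs_mul, abs_mul, abs_of_pos hl]; ring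
    have h2 : |k * l * (e - w)| ≤ y := by rw [h1]; nlinarith
    have h3 : (k * l * (e - w)) ^ 2 = 16 * k ^ 2 * y ^ 2 := by
      rw [← sq_abs, h1, mul_pow, sq_abs]; ring
    have h4 : 2 * y ≤ 1 + l / 2 * (e - x) := by
      have : |e - w| ≤ (e - x) + (w - x) := by
        rw [abs_le]; constructor <;> linarith
      nlinarith
    calc (k * l * (e - w)) ^ 2 * Real.exp |k * l * (e - w)|
        ≤ (16 * k ^ 2 * (2 * Real.exp y)) * Real.exp y := by
          rw [h3]; gcongr; exact sq_le_two_mul_exp hy0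
      _ = 32 * k ^ 2 * Real.exp (2 * y) := by rw [two_mul y, Real.exp_add]; ring
      _ ≤ 32 * k ^ 2 * Real.exp (1 + l / 2 * (e - x)) := by gcongr
      _ = _ := by rw [Real.exp_add]; ring
  · rw [Set.indicator_of_notMem (by exact hg), thresh, if_neg hg]
    simp

theorem thresh_sumSq_eq_indicator (x : ℝ) :
    (fun g : ι → ℝ => thresh ι x (∑ i, g i ^ 2)) = {g : ι → ℝ | x ≤ ∑ i, g i ^ 2}.indicator
      (fun g => (∑ i, g i ^ 2 - x) - (condMean ι x - x)) := by
  ext g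
  simp only [thresh, Set.indicator, Set.mem_ofPred_eq]
  split_ifs <;> ring

theorem integrable_thresh {x : ℝ} (hx : Fintype.card ι < x) :
    Integrable (fun g : ι → ℝ => thresh ι x (∑ i, g i ^ 2)) (stdGaussian ι) := by
  rw [thresh_sumSq_eq_indicator, integrable_indicator_iff (measurableSet_le_sumSq x)]
  exact (integrableOn_excess hx).sub (integrable_const _)

theorem integral_thresh [Nonempty ι] {x : ℝ} (hx : Fintype.card ι < x) :
    ∫ g : ι → ℝ, thresh ι x (∑ i, g i ^ 2) ∂stdGaussian ι = 0 := by
  rw [thresh_sumSq_eq_indicator, integral_indicator (measurableSet_le_sumSq x),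
    integral_sub (integrableOn_excess hx) (integrable_const _), setIntegral_excess hx,
    setIntegral_const, smul_eq_mul, mul_comm, sub_eq_zero]
  rfl

theorem integrable_exp_bound [Nonempty ι] {x : ℝ} (k : ℝ) (hx : Fintype.card ι < x) :
    Integrable (fun g : ι → ℝ => 1 + k * tailRate ι x * thresh ι x (∑ i, g i ^ 2) +
        {g : ι → ℝ | x ≤ ∑ i, g i ^ 2}.indicator (fun g => 32 * Real.exp 1 * k ^ 2 *
          Real.exp (tailRate ι x / 2 * (∑ i, g i ^ 2 - x))) g) (stdGaussian ι) := by
  refine ((integrable_const _).add ((integrable_thresh hx).const_mul _)).add ?_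
  rw [integrable_indicator_iff (measurableSet_le_sumSq x)]
  exact (integrableOn_exp_excess hx).const_mul _

theorem integrable_exp_thresh [Nonempty ι] {x k : ℝ} (hx : Fintype.card ι < x) (hk : |k| ≤ 1 / 4) :
    Integrable (fun g : ι → ℝ => Real.exp (k * tailRate ι x * thresh ι x (∑ i, g i ^ 2)))
      (stdGaussian ι) := by
  refine (integrable_exp_bound k hx).mono' ?_ (ae_of_all _ fun g => ?_)
  · have := measurable_thresh (ι := ι) x
    exact Measurable.aestronglyMeasurable (by fun_prop)
  · rw [Real.norm_of_nonneg (Real.exp_pos _).le]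
    exact exp_mul_thresh_le hx hk g

/-- A Bernstein-type bound for the moment generating function of a thresholded chi-square
variable: its variance proxy is proportional to the probability of exceeding the threshold. -/
theorem integral_exp_thresh_le [Nonempty ι] {x k : ℝ} (hx : Fintype.card ι < x)
    (hk : |k| ≤ 1 / 4) :
    ∫ g : ι → ℝ, Real.exp (k * tailRate ι x * thresh ι x (∑ i, g i ^ 2)) ∂stdGaussian ι
      ≤ Real.exp (200 * chiTail ι x * k ^ 2) := by
  refine (integral_mono (integrable_exp_thresh hx hk) (integrable_exp_bound k hx)
    (exp_mul_thresh_le hx hk)).trans ?_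
  have hi : Integrable ({g : ι → ℝ | x ≤ ∑ i, g i ^ 2}.indicator (fun g => 32 * Real.exp 1 * k ^ 2 *
          Real.exp (tailRate ι x / 2 * (∑ i, g i ^ 2 - x)))) (stdGaussian ι) := by
    rw [integrable_indicator_iff (measurableSet_le_sumSq x)]
    exact (integrableOn_exp_excess hx).const_mul _
  have hi1 : Integrable (fun g : ι → ℝ => k * tailRate ι x * thresh ι x (∑ i, g i ^ 2))
      (stdGaussian ι) := (integrable_thresh hx).const_mul _
  have hi2 : Integrable (fun g : ι → ℝ => 1 + k * tailRate ι x * thresh ι x (∑ i, g i ^ 2))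
      (stdGaussian ι) := (integrable_const _).add hi1
  rw [integral_add hi2 hi, integral_add (integrable_const _) hi1, integral_const_mul,
    integral_thresh hx, integral_indicator (measurableSet_le_sumSq x), integral_const_mul]
  have h1 := integral_exp_excess_le hx
  have h2 := Real.add_one_le_exp (200 * chiTail ι x * k ^ 2)
  -- The bound `e < 3` gives `32 * 3 * 2 = 192`, below the constant 200.
  have h3 : 32 * Real.exp 1 * k ^ 2 * ∫ g in {g : ι → ℝ | x ≤ ∑ i, g i ^ 2},
      Real.exp (tailRate ι x / 2 * (∑ i, g i ^ 2 - x)) ∂stdGaussian ι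
      ≤ 32 * 3 * k ^ 2 * (2 * chiTail ι x) := by
    have := Real.exp_one_lt_d9
    have := chiTail_nonneg (ι := ι) x
    gcongr
    linarith
  have h4 : 0 ≤ chiTail ι x * k ^ 2 := mul_nonneg (chiTail_nonneg _) (sq_nonneg _)
  simp only [integral_const, probReal_univ, smul_eq_mul, mul_one, mul_zero, add_zero]
  linarith

end

/-! ### Concentration for sums of independent blocks -/

section
variable {Ω : Type*} [MeasurableSpace Ω] {P : Measure Ω} {κ : Type*}

/-- Chernoff's bound. Since `k` may have either sign, it covers both tails. -/
theorem measure_sum_thresh_ge_le {ι : Type*} [Fintype ι] [Nonempty ι] [IsProbabilityMeasure P]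
    {X : κ → Ω → ι → ℝ} (hind : iIndepFun X P) (hm : ∀ j, AEMeasurable (X j) P)
    (s : Finset κ) (hX : ∀ j ∈ s, HasLaw (X j) (stdGaussian ι) P) {x k : ℝ}
    (hx : Fintype.card ι < x) (hk : |k| ≤ 1 / 4) (a : ℝ) :
    P.real {ω | a ≤ k * tailRate ι x * ∑ j ∈ s, thresh ι x (∑ i, X j ω i ^ 2)}
      ≤ Real.exp (-a + 200 * s.card * chiTail ι x * k ^ 2) := by
  have hφ : Measurable fun g : ι → ℝ => k * tailRate ι x * thresh ι x (∑ i, g i ^ 2) :=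
    ((measurable_thresh x).comp (by fun_prop)).const_mul _
  set Z : κ → Ω → ℝ := fun j ω => k * tailRate ι x * thresh ι x (∑ i, X j ω i ^ 2) with hZ
  have hZind : iIndepFun Z P := hind.comp (fun _ g => k * tailRate ι x * thresh ι x (∑ i, g i ^ 2))
    fun _ => hφ
  have hZm : ∀ j, AEMeasurable (Z j) P := fun j => hφ.comp_aemeasurable (hm j)
  have hmgf : ∀ j ∈ s, mgf (Z j) P 1
      = ∫ g : ι → ℝ, Real.exp (k * tailRate ι x * thresh ι x (∑ i, g i ^ 2)) ∂stdGaussian ι := by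
    intro j hj
    rw [← (hX j hj).integral_comp (f := fun g : ι → ℝ =>
      Real.exp (k * tailRate ι x * thresh ι x (∑ i, g i ^ 2))) hφ.exp.aestronglyMeasurable]
    simp [mgf, hZ]
  have hsum := hZind.mgf_sum₀ (t := 1) hZm s
  rw [Finset.prod_congr rfl hmgf, Finset.prod_const] at hsum
  set c := ∫ g : ι → ℝ, Real.exp (k * tailRate ι x * thresh ι x (∑ i, g i ^ 2)) ∂stdGaussian ι
    with hc
  have hc0 : 0 < c := integral_exp_pos (integrable_exp_thresh hx hk)
  -- A non-integrable exponential would have `mgf` equal to the default value 0, but the product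
  -- formula makes it positive.
  have hint : Integrable (fun ω => Real.exp (1 * (∑ j ∈ s, Z j) ω)) P := by
    by_contra h
    have h0 : mgf (∑ j ∈ s, Z j) P 1 = 0 := integral_undef h
    rw [h0] at hsum
    exact (pow_pos hc0 s.card).ne hsum
  have h := measure_ge_le_exp_mul_mgf a zero_le_one hint
  rw [hsum] at h
  have hset : {ω | a ≤ k * tailRate ι x * ∑ j ∈ s, thresh ι x (∑ i, X j ω i ^ 2)}
      = {ω | a ≤ (∑ j ∈ s, Z j) ω} := by
    ext ω
    simp only [Set.mem_ofPred_eq, Finset.sum_apply, hZ, Finset.mul_sum]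
  rw [hset]
  refine h.trans ?_
  rw [Real.exp_add, neg_one_mul]
  gcongr
  calc c ^ s.card ≤ Real.exp (200 * chiTail ι x * k ^ 2) ^ s.card := by
        gcongr; exact integral_exp_thresh_le hx hk
    _ = _ := by rw [← Real.exp_nat_mul]; congr 1; ring

/-! ### Moments of squared Gaussians and Chebyshev's inequality -/

theorem integrable_pow_gaussianReal (n : ℕ) :
    Integrable (fun x : ℝ => x ^ n) (gaussianReal 0 1) := by
  have h : MemLp id n (gaussianReal 0 1) := memLp_id_gaussianReal' _ (by simp)
  have h2 := h.integrable_norm_pow'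
  refine h2.mono' (by fun_prop) (ae_of_all _ fun x => ?_)
  simp

theorem integral_pow_four_gaussianReal_le : ∫ x, x ^ 4 ∂gaussianReal 0 1 ≤ 80 := by
  have hi : ∀ t : ℝ, Integrable (fun x => Real.exp (t * x)) (gaussianReal 0 1) :=
    integrable_exp_mul_gaussianReal
  have h : ∀ x : ℝ, x ^ 4 ≤ 24 * (Real.exp (1 * x) + Real.exp (-1 * x)) := by
    intro x
    have h1 := Real.pow_div_factorial_le_exp |x| (abs_nonneg x) 4
    have h2 : |x| ^ 4 = x ^ 4 := by rw [pow_abs, abs_of_nonneg (by positivity)]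
    have h3 : Real.exp |x| ≤ Real.exp (1 * x) + Real.exp (-1 * x) := by
      rw [one_mul, neg_one_mul]
      rcases abs_cases x with ⟨hx, _⟩ | ⟨hx, _⟩ <;> rw [hx]
      · linarith [Real.exp_pos (-x)]
      · linarith [Real.exp_pos x]
    rw [h2] at h1
    norm_num [Nat.factorial] at h1
    linarith
  refine (integral_mono (integrable_pow_gaussianReal 4) (((hi 1).add (hi (-1))).const_mul 24)
    h).trans ?_
  have hm : ∀ t : ℝ, ∫ x, Real.exp (t * x) ∂gaussianReal 0 1 = Real.exp (t ^ 2 / 2) := by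
    intro t
    have := congrFun (mgf_fun_id_gaussianReal (μ := 0) (v := 1)) t
    simpa [mgf] using this
  rw [integral_const_mul]
  simp only [Pi.add_apply]
  rw [integral_add (hi 1) (hi (-1)), hm, hm]
  have h1 : Real.exp (1 / 2) ^ 2 = Real.exp 1 := by rw [← Real.exp_nat_mul]; norm_num
  have := Real.exp_one_lt_d9
  have h2 : Real.exp (1 / 2) ≤ 1.65 := by nlinarith [Real.exp_pos (1 / 2)]
  norm_num at h2 ⊢
  linarith

theorem memLp_sq_of_gaussian {X : Ω → ℝ} {m : ℝ} (hX : HasLaw X (gaussianReal m 1) P) :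
    MemLp (fun ω => X ω ^ 2) 2 P := by
  have h : MemLp id 4 (gaussianReal m 1) := memLp_id_gaussianReal' _ (by simp)
  rw [← hX.map_eq] at h
  have h2 : MemLp X 4 P := by
    have := (memLp_map_measure_iff (by fun_prop) hX.aemeasurable).1 h
    simpa using this
  have h3 := h2.norm_rpow_div 2
  have e : (4 : ℝ≥0∞) / 2 = 2 := by
    rw [show (4 : ℝ≥0∞) = 2 * 2 by norm_num]
    exact ENNReal.mul_div_cancel_right (by simp) (by simp)
  rw [e] at h3
  simpa using h3

theorem hasLaw_sub_mean {X : Ω → ℝ} {m : ℝ} (hX : HasLaw X (gaussianReal m 1) P) :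
    HasLaw (fun ω => X ω - m) (gaussianReal 0 1) P := by
  have := gaussianReal_sub_const hX m
  rwa [sub_self] at this

theorem integral_sq_of_gaussian [IsProbabilityMeasure P] {X : Ω → ℝ} {m : ℝ}
    (hX : HasLaw X (gaussianReal m 1) P) :
    ∫ ω, X ω ^ 2 ∂P = m ^ 2 + 1 := by
  have hZ := hasLaw_sub_mean hX
  have h1 : ∫ ω, X ω ^ 2 ∂P = ∫ x, (m + x) ^ 2 ∂gaussianReal 0 1 := by
    rw [← hZ.integral_comp (f := fun x => (m + x) ^ 2) (by fun_prop)]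
    simp
  have i1 : Integrable (fun x : ℝ => x) (gaussianReal 0 1) := by
    simpa using integrable_pow_gaussianReal 1
  have hv : ∫ x, x ^ 2 ∂gaussianReal 0 1 = 1 := by
    have h := variance_fun_id_gaussianReal (μ := 0) (v := 1)
    rw [variance_eq_integral (by fun_prop)] at h
    simpa using h
  have e : ∀ x : ℝ, (m + x) ^ 2 = m ^ 2 + 2 * m * x + x ^ 2 := fun x => by ring
  rw [h1]
  simp_rw [e]
  have i2 : Integrable (fun x : ℝ => 2 * m * x) (gaussianReal 0 1) := i1.const_mul _
  have i3 : Integrable (fun x : ℝ => m ^ 2 + 2 * m * x) (gaussianReal 0 1) :=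
    (integrable_const _).add i2
  rw [integral_add i3 (integrable_pow_gaussianReal 2),
    integral_add (integrable_const _) i2, integral_const_mul, hv,
    integral_id_gaussianReal]
  simp

theorem variance_sq_of_gaussian_le [IsProbabilityMeasure P] {X : Ω → ℝ} {m : ℝ}
    (hX : HasLaw X (gaussianReal m 1) P) :
    Var[fun ω => X ω ^ 2; P] ≤ 8 * m ^ 2 + 162 := by
  have hZ := hasLaw_sub_mean hX
  have hv : ∫ x, x ^ 2 ∂gaussianReal 0 1 = 1 := by
    have h := variance_fun_id_gaussianReal (μ := 0) (v := 1)
    rw [variance_eq_integral (by fun_prop)] at h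
    simpa using h
  rw [variance_eq_integral (hX.aemeasurable.pow_const 2), integral_sq_of_gaussian hX]
  have h1 : ∫ ω, (X ω ^ 2 - (m ^ 2 + 1)) ^ 2 ∂P
      = ∫ x, ((m + x) ^ 2 - (m ^ 2 + 1)) ^ 2 ∂gaussianReal 0 1 := by
    rw [← hZ.integral_comp (f := fun x => ((m + x) ^ 2 - (m ^ 2 + 1)) ^ 2) (by fun_prop)]
    simp
  have i2 := (integrable_pow_gaussianReal 2).const_mul (8 * m ^ 2)
  have i4 := (integrable_pow_gaussianReal 4).const_mul 2
  have i24 : Integrable (fun x : ℝ => 8 * m ^ 2 * x ^ 2 + 2 * x ^ 4) (gaussianReal 0 1) :=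
    i2.add i4
  have h2 : ∫ x, ((m + x) ^ 2 - (m ^ 2 + 1)) ^ 2 ∂gaussianReal 0 1
      ≤ ∫ x, (8 * m ^ 2 * x ^ 2 + 2 * x ^ 4) + 2 ∂gaussianReal 0 1 := by
    refine integral_mono_of_nonneg (ae_of_all _ fun x => sq_nonneg _)
      (i24.add (integrable_const _)) (ae_of_all _ fun x => ?_)
    simp only
    -- The difference is `2mx + (x² - 1)`, and `(a + b)² ≤ 2a² + 2b²`.
    nlinarith [sq_nonneg (2 * m * x - (x ^ 2 - 1)), sq_nonneg x]
  rw [integral_add i24 (integrable_const _), integral_add i2 i4, integral_const_mul,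
    integral_const_mul, hv] at h2
  have := integral_pow_four_gaussianReal_le
  simp only [integral_const, probReal_univ, smul_eq_mul, mul_one] at h2
  linarith

/-- Chebyshev's inequality for the lower tail of a noncentral chi-square variable. -/
theorem measure_sum_sq_le_le [IsProbabilityMeasure P] {X : κ → Ω → ℝ} (hind : iIndepFun X P)
    {m : κ → ℝ} (s : Finset κ) (hX : ∀ i ∈ s, HasLaw (X i) (gaussianReal (m i) 1) P)
    (hM : 0 < ∑ i ∈ s, m i ^ 2) :
    P.real {ω | ∑ i ∈ s, X i ω ^ 2 ≤ s.card + (∑ i ∈ s, m i ^ 2) / 2}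
      ≤ 32 / (∑ i ∈ s, m i ^ 2) + 648 * s.card / (∑ i ∈ s, m i ^ 2) ^ 2 := by
  set M := ∑ i ∈ s, m i ^ 2 with hMdef
  have hLp : ∀ i ∈ s, MemLp (fun ω => X i ω ^ 2) 2 P := fun i hi => memLp_sq_of_gaussian (hX i hi)
  have hmean : ∫ ω, (∑ i ∈ s, fun ω => X i ω ^ 2) ω ∂P = M + s.card := by
    simp only [Finset.sum_apply]
    rw [integral_finsetSum _ fun i hi => (hLp i hi).integrable (by norm_num),
      Finset.sum_congr rfl fun i hi => integral_sq_of_gaussian (hX i hi), Finset.sum_add_distrib]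
    simp [hMdef]
  have hvar : Var[∑ i ∈ s, fun ω => X i ω ^ 2; P] ≤ 8 * M + 162 * s.card := by
    rw [IndepFun.variance_sum hLp]
    · refine (Finset.sum_le_sum fun i hi => variance_sq_of_gaussian_le (hX i hi)).trans ?_
      rw [Finset.sum_add_distrib, ← Finset.mul_sum, ← hMdef]
      simp [mul_comm]
    · intro i _ j _ hij
      exact (hind.indepFun hij).comp (measurable_id.pow_const 2) (measurable_id.pow_const 2)
  have hch := meas_ge_le_variance_div_sq (memLp_finsetSum' s hLp) (half_pos hM)
  rw [hmean] at hch
  have hsub : {ω | ∑ i ∈ s, X i ω ^ 2 ≤ s.card + M / 2}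
      ⊆ {ω | M / 2 ≤ |(∑ i ∈ s, fun ω => X i ω ^ 2) ω - (M + s.card)|} := by
    intro ω hω
    simp only [Set.mem_ofPred_eq, Finset.sum_apply] at hω ⊢
    rw [abs_sub_comm]
    exact le_trans (by linarith) (le_abs_self _)
  have h1 := ENNReal.toReal_le_of_le_ofReal (div_nonneg (variance_nonneg _ _) (sq_nonneg _))
    ((measure_mono hsub).trans hch)
  refine h1.trans ?_
  calc _ ≤ (8 * M + 162 * s.card) / (M / 2) ^ 2 := by gcongr
    _ = _ := by field_simp; ring

end

/-! ### The unit ball of the reproducing kernel Hilbert space -/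

namespace IsEigensystem

open Filter Topology

variable {H : Type*} [NormedAddCommGroup H] [InnerProductSpace ℝ H] [CompleteSpace H]
  [RKHS ℝ H I ℝ] {μ : ℕ → ℝ} {ψ : ℕ → I → ℝ}

/-- The embedding of the space into `L²`. -/
noncomputable def toL2 (h : IsEigensystem H μ ψ) : H →L[ℝ] Lp ℝ 2 (volume : Measure I) where
  toFun f := (h.memLp_coe f).toLp
  map_add' f g := by
    rw [← MemLp.toLp_add]
    exact MemLp.toLp_congr _ _ (by simp [Pi.add_def])
  map_smul' c f := by
    rw [RingHom.id_apply, ← MemLp.toLp_const_smul]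
    exact MemLp.toLp_congr _ _ (by simp [Pi.smul_def])
  cont := by
    let g : H →ₗ[ℝ] Lp ℝ 2 (volume : Measure I) :=
      { toFun := fun f => (h.memLp_coe f).toLp
        map_add' := fun f g => by
          rw [← MemLp.toLp_add]
          exact MemLp.toLp_congr _ _ (by simp [Pi.add_def])
        map_smul' := fun c f => by
          rw [RingHom.id_apply, ← MemLp.toLp_const_smul]
          exact MemLp.toLp_congr _ _ (by simp [Pi.smul_def]) }
    -- Closed graph theorem: an `L²` limit is an a.e. limit along a subsequence, while convergence
    -- in `H` is pointwise because evaluations are continuous.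
    refine g.continuous_of_seq_closed_graph fun u x y hu hy => ?_
    obtain ⟨ns, hns, hae⟩ := (tendstoInMeasure_of_tendsto_Lp hy).exists_seq_tendsto_ae
    have hcoe : ∀ᵐ t ∂(volume : Measure I), ∀ i, (g (u i) : I → ℝ) t = u i t :=
      ae_all_iff.2 fun i => MemLp.coeFn_toLp (h.memLp_coe (u i))
    refine Lp.ext ?_
    filter_upwards [hae, hcoe, MemLp.coeFn_toLp (h.memLp_coe x)] with t h1 h2 h3
    refine Eq.trans ?_ h3.symm
    refine tendsto_nhds_unique h1 ?_
    simp only [Function.comp_apply, h2]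
    exact (((RKHS.continuous_eval (H := H) t).tendsto x).comp hu).comp hns.tendsto_atTop

theorem toL2_apply (h : IsEigensystem H μ ψ) (f : H) : h.toL2 f = (h.memLp_coe f).toLp := rfl

/-- The eigenfunctions as elements of `L²`. -/
noncomputable def eig (h : IsEigensystem H μ ψ) (k : ℕ) : Lp ℝ 2 (volume : Measure I) :=
  (h.memLp k).toLp

theorem inner_toLp {f g : I → ℝ} (hf : MemLp f 2 (volume : Measure I))
    (hg : MemLp g 2 (volume : Measure I)) :
    inner ℝ hf.toLp hg.toLp = ∫ x, f x * g x := by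
  rw [L2.inner_def]
  refine integral_congr_ae ?_
  filter_upwards [hf.coeFn_toLp, hg.coeFn_toLp] with x h1 h2
  rw [h1, h2]
  simp [mul_comm]

theorem orthonormal_eig (h : IsEigensystem H μ ψ) : Orthonormal ℝ h.eig := by
  rw [orthonormal_iff_ite]
  intro k l
  rw [eig, eig, inner_toLp, h.orthonormal]

/-- Orthonormality makes the series converge in `L²`. A subsequence converges a.e., which identifies
its limit with the pointwise sum. -/
theorem hasSum_smul_eig (h : IsEigensystem H μ ψ) {a : ℕ → ℝ} (ha : Summable fun k => a k ^ 2)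
    {F : I → ℝ} (hF : MemLp F 2 (volume : Measure I))
    (hs : ∀ x, HasSum (fun k => a k * ψ k x) (F x)) :
    HasSum (fun k => a k • h.eig k) hF.toLp := by
  have hsum : Summable fun k => a k • h.eig k := by
    have := (h.orthonormal_eig.orthogonalFamily).summable_iff_norm_sq_summable a
    simp only [LinearIsometry.toSpanSingleton_apply, Real.norm_eq_abs, sq_abs] at this
    exact this.2 ha
  have hlim := hsum.hasSum.tendsto_sum_nat
  obtain ⟨ns, hns, hae⟩ := (tendstoInMeasure_of_tendsto_Lp hlim).exists_seq_tendsto_ae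
  have hcoe : ∀ᵐ t ∂(volume : Measure I), ∀ n,
      ((∑ k ∈ Finset.range n, a k • h.eig k : Lp ℝ 2 (volume : Measure I)) : I → ℝ) t
        = ∑ k ∈ Finset.range n, a k * ψ k t := by
    refine ae_all_iff.2 fun n => ?_
    have h1 : ∀ᵐ t ∂(volume : Measure I), ∀ k,
        ((a k • h.eig k : Lp ℝ 2 (volume : Measure I)) : I → ℝ) t = a k * ψ k t := by
      refine ae_all_iff.2 fun k => ?_
      filter_upwards [Lp.coeFn_smul (a k) (h.eig k), (h.memLp k).coeFn_toLp] with t h2 h3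
      rw [h2, Pi.smul_apply, eig, h3, smul_eq_mul]
    have h4 : ((∑ k ∈ Finset.range n, a k • h.eig k : Lp ℝ 2 (volume : Measure I)) : I → ℝ)
        =ᵐ[volume] ∑ k ∈ Finset.range n, ⇑(a k • h.eig k) := by
      exact Lp.coeFn_finsetSum _ _
    filter_upwards [h1, h4] with t h5 h6
    rw [h6, Finset.sum_apply]
    exact Finset.sum_congr rfl fun k _ => h5 k
  have heq : ∑' k, a k • h.eig k = hF.toLp := by
    refine Lp.ext ?_
    filter_upwards [hae, hcoe, hF.coeFn_toLp] with t h1 h2 h3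
    rw [h3]
    refine tendsto_nhds_unique h1 ?_
    simp only [h2]
    exact (hs t).tendsto_sum_nat.comp hns.tendsto_atTop
  rw [← heq]
  exact hsum.hasSum

theorem eigenvalue_le_one (h : IsEigensystem H μ ψ) (k : ℕ) : μ k ≤ 1 :=
  h.top_eq_one ▸ h.antitone (Nat.zero_le k)

theorem hasSum_toL2_kerFun (h : IsEigensystem H μ ψ) (x : I) :
    HasSum (fun k => (μ k * ψ k x) • h.eig k) (h.toL2 (RKHS.kerFun H x 1)) := by
  refine h.hasSum_smul_eig ?_ (h.memLp_coe _) fun y => ?_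
  -- Since `μ k ≤ 1`, the squared coefficients are dominated by the kernel expansion on the
  -- diagonal.
  · refine Summable.of_nonneg_of_le (fun k => sq_nonneg _) (fun k => ?_)
      (h.kernel_expansion x x).summable
    have h0 := h.nonneg k
    have h1 := h.eigenvalue_le_one k
    have : (μ k * ψ k x) ^ 2 = μ k * (μ k * ψ k x * ψ k x) := by ring
    rw [this]
    have h2 : 0 ≤ μ k * ψ k x * ψ k x := by rw [mul_assoc]; exact mul_nonneg h0 (mul_self_nonneg _)
    exact mul_le_of_le_one_left h2 h1
  · rw [RKHS.kerFun_apply]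
    simpa [mul_right_comm] using h.kernel_expansion y x

/-- Reproducing property: evaluating the adjoint at `x` is the same as pairing `g` with the embedded
kernel section at `x`. -/
theorem hasSum_adjoint_apply (h : IsEigensystem H μ ψ) (g : Lp ℝ 2 (volume : Measure I)) (x : I) :
    HasSum (fun k => μ k * inner ℝ (h.eig k) g * ψ k x) (h.toL2.adjoint g x) := by
  have h1 : h.toL2.adjoint g x = ((innerSL ℝ).flip g) (h.toL2 (RKHS.kerFun H x 1)) := by
    rw [ContinuousLinearMap.flip_apply, innerSL_apply_apply, ← ContinuousLinearMap.adjoint_inner_right, RKHS.kerFun_inner]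
    simp
  rw [h1]
  have h2 := (h.hasSum_toL2_kerFun x).mapL ((innerSL ℝ).flip g)
  convert! h2 using 2 with k
  rw [ContinuousLinearMap.flip_apply, innerSL_apply_apply, inner_smul_left]
  simp
  ring

/-- With `T` the embedding, `‖T* g‖² = ⟪T T* g, g⟫`, and `T T*` is the kernel operator, diagonal in
the eigenfunctions. -/
theorem norm_adjoint_sq (h : IsEigensystem H μ ψ) (g : Lp ℝ 2 (volume : Measure I)) :
    HasSum (fun k => μ k * inner ℝ (h.eig k) g ^ 2) (‖h.toL2.adjoint g‖ ^ 2) := by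
  have hs : Summable fun k => (μ k * inner ℝ (h.eig k) g) ^ 2 := by
    have hb := h.orthonormal_eig.inner_products_summable g
    refine Summable.of_nonneg_of_le (fun k => sq_nonneg _) (fun k => ?_) hb
    rw [mul_pow, Real.norm_eq_abs, sq_abs]
    exact mul_le_of_le_one_left (sq_nonneg _) (pow_le_one₀ (h.nonneg k) (h.eigenvalue_le_one k))
  have h1 := h.hasSum_smul_eig hs (h.memLp_coe (h.toL2.adjoint g)) (h.hasSum_adjoint_apply g)
  have h2 := h1.mapL ((innerSL ℝ).flip g)
  have h3 : ((innerSL ℝ).flip g) (h.memLp_coe (h.toL2.adjoint g)).toLp = ‖h.toL2.adjoint g‖ ^ 2 := by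
    rw [← real_inner_self_eq_norm_sq, ContinuousLinearMap.adjoint_inner_right]
    rfl
  rw [h3] at h2
  convert! h2 using 2 with k
  rw [ContinuousLinearMap.flip_apply, innerSL_apply_apply, inner_smul_left]
  simp
  ring

/-- Functions in the unit ball are approximated in `L²` by their leading `N` coefficients with
squared error at most the `N`-th eigenvalue. -/
theorem integral_sq_sub_le (h : IsEigensystem H μ ψ) {f : H} (hf : ‖f‖ ≤ 1) (N : ℕ) :
    (∫ x, f x ^ 2) - ∑ k ∈ Finset.range N, (∫ x, f x * ψ k x) ^ 2 ≤ μ N := by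
  set F := h.toL2 f with hF
  set a : ℕ → ℝ := fun k => inner ℝ (h.eig k) F with ha
  have hak : ∀ k, ∫ x, f x * ψ k x = a k := by
    intro k
    simp only [ha, hF, toL2_apply, eig, inner_toLp]
    simp_rw [mul_comm]
  have hFF : ∫ x, f x ^ 2 = ‖F‖ ^ 2 := by
    rw [← real_inner_self_eq_norm_sq, hF, toL2_apply, inner_toLp]
    simp_rw [sq]
  simp_rw [hak]
  rw [hFF]
  set u := ∑ k ∈ Finset.range N, a k • h.eig k with hu
  set v := F - u with hv
  have hev : ∀ k, inner ℝ (h.eig k) v = if k < N then 0 else a k := by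
    intro k
    rw [hv, inner_sub_right, hu]
    split_ifs with hk
    · rw [h.orthonormal_eig.inner_right_sum _ (Finset.mem_range.2 hk)]
      exact sub_self _
    · rw [inner_sum, Finset.sum_eq_zero, sub_zero]
      intro l hl
      have : k ≠ l := by rintro rfl; exact hk (Finset.mem_range.1 hl)
      rw [inner_smul_right, h.orthonormal_eig.2 this, mul_zero]
  have huv : inner ℝ u v = 0 := by
    rw [hu, sum_inner]
    refine Finset.sum_eq_zero fun k hk => ?_
    rw [inner_smul_left, hev, if_pos (Finset.mem_range.1 hk), mul_zero]
  have huu : ‖u‖ ^ 2 = ∑ k ∈ Finset.range N, a k ^ 2 := by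
    rw [← real_inner_self_eq_norm_sq, hu, h.orthonormal_eig.inner_sum]
    simp [sq]
  have hFv : inner ℝ F v = ‖v‖ ^ 2 := by
    have : F = u + v := by rw [hv]; abel
    rw [this, inner_add_left, huv, zero_add, real_inner_self_eq_norm_sq]
  have hpy : ‖F‖ ^ 2 - ∑ k ∈ Finset.range N, a k ^ 2 = ‖v‖ ^ 2 := by
    have : F = u + v := by rw [hv]; abel
    rw [this, norm_add_sq_real, huv, huu]; ring
  rw [hpy]
  -- Duality replaces an expansion of `f` in `H`: `‖v‖² = ⟪f, T* v⟫ ≤ ‖T* v‖`. Moreover `‖T* v‖² ≤ μ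
  -- N ‖v‖²`, because the remainder `v` has no coefficients below `N`.
  have h1 : ‖v‖ ^ 2 ≤ ‖h.toL2.adjoint v‖ := by
    rw [← hFv, hF, ← ContinuousLinearMap.adjoint_inner_right]
    refine (real_inner_le_norm _ _).trans ?_
    exact mul_le_of_le_one_left (norm_nonneg _) hf
  have h2 : ‖h.toL2.adjoint v‖ ^ 2 ≤ μ N * ‖v‖ ^ 2 := by
    have hb := h.orthonormal_eig.inner_products_summable v
    have hb2 := h.orthonormal_eig.tsum_inner_products_le v
    simp only [Real.norm_eq_abs, sq_abs] at hb hb2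
    rw [← (h.norm_adjoint_sq v).tsum_eq]
    calc _ ≤ ∑' k, μ N * inner ℝ (h.eig k) v ^ 2 := by
          refine (h.norm_adjoint_sq v).summable.tsum_le_tsum (fun k => ?_) (hb.mul_left _)
          by_cases hk : k < N
          · rw [hev, if_pos hk]; simp
          · exact mul_le_mul_of_nonneg_right (h.antitone (not_lt.1 hk)) (sq_nonneg _)
      _ ≤ _ := by
          rw [tsum_mul_left]
          exact mul_le_mul_of_nonneg_left hb2 (h.nonneg N)
  have h3 : ‖v‖ ^ 2 * ‖v‖ ^ 2 ≤ μ N * ‖v‖ ^ 2 := by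
    refine le_trans ?_ h2
    rw [← sq]
    exact pow_le_pow_left₀ (sq_nonneg _) h1 2
  rcases (sq_nonneg ‖v‖).eq_or_lt with h0 | h0
  · rw [← h0]; exact h.nonneg N
  · exact le_of_mul_le_mul_right h3 h0

end IsEigensystem

/-! ### The sequence model -/

section
variable {p : ℕ}

theorem measurePreserving_eval_cube (j : Fin p) :
    MeasurePreserving (fun x : Fin p → I => x j) volume volume :=
  measurePreserving_eval (fun _ : Fin p => (volume : Measure I)) j

theorem memLp_comp_eval {a : I → ℝ} (ha : MemLp a 2 (volume : Measure I)) (j : Fin p) :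
    MemLp (fun x : Fin p → I => a (x j)) 2 volume :=
  ha.comp_measurePreserving (measurePreserving_eval_cube j)

theorem integral_comp_eval_cube {a : I → ℝ} (ha : AEStronglyMeasurable a (volume : Measure I))
    (j : Fin p) : ∫ x : Fin p → I, a (x j) = ∫ x, a x := by
  have h := measurePreserving_eval_cube j
  rw [← h.map_eq, integral_map h.measurable.aemeasurable (by rwa [h.map_eq])]

theorem integral_mul_comp_eval {a b : I → ℝ} (ha : MemLp a 2 (volume : Measure I))
    (hb : MemLp b 2 (volume : Measure I)) (i j : Fin p) :
    ∫ x : Fin p → I, a (x i) * b (x j)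
      = if i = j then ∫ x, a x * b x else (∫ x, a x) * ∫ x, b x := by
  split_ifs with hij
  · subst hij
    exact integral_comp_eval_cube (a := fun x => a x * b x) (ha.1.mul hb.1) i
  · have hind : iIndepFun (fun (i : Fin p) (x : Fin p → I) => x i) volume :=
      iIndepFun_pi (μ := fun _ : Fin p => (volume : Measure I)) (X := fun _ x => x)
        fun _ => aemeasurable_id
    have h2 := (hind.indepFun hij).comp₀ (φ := a) (ψ := b) (measurable_pi_apply i).aemeasurable
      (measurable_pi_apply j).aemeasurable (by rw [(measurePreserving_eval_cube i).map_eq]; exact ha.1.aemeasurable)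
      (by rw [(measurePreserving_eval_cube j).map_eq]; exact hb.1.aemeasurable)
    have h3 := h2.integral_fun_mul_eq_mul_integral (memLp_comp_eval ha i).1 (memLp_comp_eval hb j).1
    refine h3.trans ?_
    congr 1
    · exact integral_comp_eval_cube ha.1 i
    · exact integral_comp_eval_cube hb.1 j

end

/-- The normalized data `√n X_{k,j}`. -/
noncomputable def normData {Ω : Type*} {p : ℕ} (n : ℕ) (ψ : ℕ → I → ℝ)
    (Y : ((Fin p → I) → ℝ) → Ω → ℝ) (j : Fin p) (k : ℕ) (ω : Ω) : ℝ :=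
  √n * seqData ψ Y ω k j

theorem sum_normData_sq {Ω : Type*} {p : ℕ} (n : ℕ) (ψ : ℕ → I → ℝ)
    (Y : ((Fin p → I) → ℝ) → Ω → ℝ) (j : Fin p) (d : ℕ) (ω : Ω) :
    ∑ k : Fin d, normData n ψ Y j k ω ^ 2 = energy n (seqData ψ Y ω) d j := by
  rw [energy, Finset.mul_sum, ← Fin.sum_univ_eq_sum_range
    (fun k => (n : ℝ) * seqData ψ Y ω k j ^ 2)]
  refine Finset.sum_congr rfl fun k _ => ?_
  rw [normData, mul_pow, Real.sq_sqrt (Nat.cast_nonneg n)]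

section
variable {H : Type*} [NormedAddCommGroup H] [InnerProductSpace ℝ H] [CompleteSpace H]
  [RKHS ℝ H I ℝ] {μ : ℕ → ℝ} {ψ : ℕ → I → ℝ} {n p : ℕ} {Ω : Type*} [MeasurableSpace Ω]
  {P : Measure Ω} {Y : ((Fin p → I) → ℝ) → Ω → ℝ}

theorem IsEigensystem.integral_eigen_mul (h : IsEigensystem H μ ψ) (a b : Fin p × ℕ) :
    ∫ x : Fin p → I, ψ a.2 (x a.1) * ψ b.2 (x b.1) = if a = b then 1 else 0 := by
  rw [integral_mul_comp_eval (h.memLp a.2) (h.memLp b.2), h.orthonormal, h.integral_eq_zero,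
    zero_mul]
  rcases a with ⟨i, k⟩
  rcases b with ⟨j, l⟩
  by_cases h1 : i = j <;> by_cases h2 : k = l <;> simp [h1, h2]

/-! ### Law of the normalized coefficients -/

section
variable {f : (Fin p → I) → ℝ}

theorem isGaussianProcess_normData (h : IsEigensystem H μ ψ) (hw : IsWhiteNoise n f P Y)
    {T : Type*} (u : T → Fin p × ℕ) :
    IsGaussianProcess (fun t ω => normData n ψ Y (u t).1 (u t).2 ω) P := by
  refine hw.gaussian.of_isGaussianProcess fun t => ?_
  let g : {g : (Fin p → I) → ℝ // MemLp g 2 (volume : Measure (Fin p → I))} :=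
    ⟨fun x => ψ (u t).2 (x (u t).1), memLp_comp_eval (h.memLp _) _⟩
  exact ⟨{g}, √n • ContinuousLinearMap.proj ⟨g, Finset.mem_singleton_self g⟩, fun ω => rfl⟩

theorem covariance_normData (h : IsEigensystem H μ ψ) (hw : IsWhiteNoise n f P Y) (hn : 1 ≤ n)
    (a b : Fin p × ℕ) :
    cov[normData n ψ Y a.1 a.2, normData n ψ Y b.1 b.2; P] = if a = b then 1 else 0 := by
  have hn0 : (0 : ℝ) < n := by exact_mod_cast hn
  have h1 := hw.covariance (fun x => ψ a.2 (x a.1)) (fun x => ψ b.2 (x b.1))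
    (memLp_comp_eval (h.memLp _) _) (memLp_comp_eval (h.memLp _) _)
  rw [h.integral_eigen_mul] at h1
  change cov[fun ω => √n * Y (fun x => ψ a.2 (x a.1)) ω,
    fun ω => √n * Y (fun x => ψ b.2 (x b.1)) ω; P] = _
  rw [covariance_const_mul_left, covariance_const_mul_right, h1, ← mul_assoc,
    Real.mul_self_sqrt hn0.le, mul_div_cancel₀ _ hn0.ne']

theorem hasLaw_normData (h : IsEigensystem H μ ψ) (hw : IsWhiteNoise n f P Y) (hn : 1 ≤ n)
    (a : Fin p × ℕ) :
    HasLaw (normData n ψ Y a.1 a.2)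
      (gaussianReal (√n * ∫ x : Fin p → I, f x * ψ a.2 (x a.1)) 1) P := by
  have hg : HasGaussianLaw (normData n ψ Y a.1 a.2) P :=
    (isGaussianProcess_normData h hw id).hasGaussianLaw_eval a
  refine ⟨hg.aemeasurable, ?_⟩
  have hv := covariance_normData h hw hn a a
  rw [if_pos rfl, covariance_self hg.aemeasurable] at hv
  have hm : ∫ ω, normData n ψ Y a.1 a.2 ω ∂P = √n * ∫ x : Fin p → I, f x * ψ a.2 (x a.1) := by
    rw [← hw.mean _ (memLp_comp_eval (h.memLp _) _), ← integral_const_mul]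
    rfl
  rw [hg.map_eq_gaussianReal]
  change gaussianReal (∫ ω, normData n ψ Y a.1 a.2 ω ∂P) (Var[normData n ψ Y a.1 a.2; P]).toNNReal
    = _
  rw [hm, hv, Real.toNNReal_one]

/-- Uncorrelated and jointly Gaussian. Orthogonality across different coordinates comes from the
eigenfunctions being centered. -/
theorem iIndepFun_normData (h : IsEigensystem H μ ψ) (hw : IsWhiteNoise n f P Y) (hn : 1 ≤ n) :
    iIndepFun (fun (a : Fin p × ℕ) => normData n ψ Y a.1 a.2) P := by
  have h1 := IsGaussianProcess.iIndepFun_of_covariance_eq_zero (S := fun _ : Fin p × ℕ => Unit)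
    (X := fun a _ => normData n ψ Y a.1 a.2) (P := P)
    (isGaussianProcess_normData h hw fun t : (_ : Fin p × ℕ) × Unit => t.1)
    (fun a _ => (hasLaw_normData h hw hn a).aemeasurable)
    (fun a b hab _ _ => by rw [covariance_normData h hw hn, if_neg hab])
  exact h1.comp (fun _ x => x ()) fun _ => measurable_pi_apply _

theorem iIndepFun_normData_block (h : IsEigensystem H μ ψ) (hw : IsWhiteNoise n f P Y)
    (hn : 1 ≤ n) (d : ℕ) :
    iIndepFun (fun (j : Fin p) ω (k : Fin d) => normData n ψ Y j k ω) P := by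
  refine IsGaussianProcess.iIndepFun_of_covariance_eq_zero (S := fun _ : Fin p => Fin d)
    (X := fun j k => normData n ψ Y j k) (P := P)
    (isGaussianProcess_normData h hw fun t : (_ : Fin p) × Fin d => (t.1, (t.2 : ℕ)))
    (fun j k => (hasLaw_normData h hw hn (j, (k : ℕ))).aemeasurable)
    (fun i j hij k l => ?_)
  have := covariance_normData h hw hn (i, (k : ℕ)) (j, (l : ℕ))
  rw [this, if_neg]
  simp [hij]

theorem hasLaw_normData_block (h : IsEigensystem H μ ψ) (hw : IsWhiteNoise n f P Y)
    (hn : 1 ≤ n) (d : ℕ) (j : Fin p) (hj : ∀ k, ∫ x : Fin p → I, f x * ψ k (x j) = 0) :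
    HasLaw (fun ω (k : Fin d) => normData n ψ Y j k ω) (stdGaussian (Fin d)) P := by
  have hlaw : ∀ k : Fin d, HasLaw (normData n ψ Y j k) (gaussianReal 0 1) P := fun k => by
    have := hasLaw_normData h hw hn (j, (k : ℕ))
    simpa [hj] using this
  have hm : ∀ k : Fin d, AEMeasurable (normData n ψ Y j k) P := fun k => (hlaw k).aemeasurable
  have hind : iIndepFun (fun (k : Fin d) => normData n ψ Y j k) P :=
    (iIndepFun_normData h hw hn).precomp (g := fun k : Fin d => (j, (k : ℕ)))
      fun k l hkl => by simpa [Fin.ext_iff] using hkl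
  have := hw.gaussian.isProbabilityMeasure
  refine ⟨aemeasurable_pi_lambda _ hm, ?_⟩
  refine ((iIndepFun_iff_map_fun_eq_pi_map hm).1 hind).trans ?_
  exact congrArg Measure.pi (funext fun k => (hlaw k).map_eq)

end

/-! ### Norms and coefficients of additive signals -/

theorem memLp_additive (h : IsEigensystem H μ ψ) (S : Finset (Fin p)) (g : Fin p → H) :
    MemLp (fun x : Fin p → I => ∑ j ∈ S, g j (x j)) 2 volume :=
  memLp_finsetSum S fun j _ => memLp_comp_eval (h.memLp_coe (g j)) j

theorem integral_additive_mul (h : IsEigensystem H μ ψ) (S : Finset (Fin p)) (g : Fin p → H)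
    {b : I → ℝ} (hb : MemLp b 2 (volume : Measure I)) (j : Fin p) :
    ∫ x : Fin p → I, (∑ i ∈ S, g i (x i)) * b (x j)
      = if j ∈ S then ∫ x, g j x * b x else 0 := by
  simp_rw [Finset.sum_mul]
  have hi : ∀ i ∈ S, Integrable (fun x : Fin p → I => g i (x i) * b (x j)) volume := fun i _ =>
    (memLp_comp_eval (h.memLp_coe (g i)) i).integrable_mul (memLp_comp_eval hb j)
  rw [integral_finsetSum _ hi]
  have e : ∀ i, ∫ x : Fin p → I, g i (x i) * b (x j)
      = if i = j then ∫ x, g i x * b x else 0 := fun i => by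
    rw [integral_mul_comp_eval (h.memLp_coe (g i)) hb, h.integral_coe, zero_mul]
  simp_rw [e]
  rw [Finset.sum_ite_eq']

theorem integral_additive_sq (h : IsEigensystem H μ ψ) (S : Finset (Fin p)) (g : Fin p → H) :
    ∫ x : Fin p → I, (∑ i ∈ S, g i (x i)) ^ 2 = ∑ j ∈ S, ∫ x, g j x ^ 2 := by
  have e : ∀ x : Fin p → I, (∑ i ∈ S, g i (x i)) ^ 2
      = ∑ j ∈ S, (∑ i ∈ S, g i (x i)) * g j (x j) := fun x => by rw [sq, Finset.mul_sum]
  simp_rw [e]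
  have hi : ∀ j ∈ S, Integrable (fun x : Fin p → I => (∑ i ∈ S, g i (x i)) * g j (x j)) volume :=
    fun j _ => (memLp_additive h S g).integrable_mul (memLp_comp_eval (h.memLp_coe (g j)) j)
  rw [integral_finsetSum _ hi]
  refine Finset.sum_congr rfl fun j hj => ?_
  rw [integral_additive_mul h S g (h.memLp_coe (g j)), if_pos hj]
  simp_rw [sq]

/-- Truncating at level `N` loses at most `|S| μ_N` of the squared norm of an additive signal. -/
theorem sum_signal_ge (h : IsEigensystem H μ ψ) (S : Finset (Fin p)) (g : Fin p → H)
    (hg : ∀ j ∈ S, ‖g j‖ ≤ 1) (N : ℕ) :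
    (∫ x : Fin p → I, (∑ i ∈ S, g i (x i)) ^ 2) - S.card * μ N
      ≤ ∑ j ∈ S, ∑ k ∈ Finset.range N,
        (∫ x : Fin p → I, (∑ i ∈ S, g i (x i)) * ψ k (x j)) ^ 2 := by
  rw [integral_additive_sq h, sub_le_iff_le_add, ← nsmul_eq_mul, ← Finset.sum_const,
    ← Finset.sum_add_distrib]
  refine Finset.sum_le_sum fun j hj => ?_
  have e : ∀ k, ∫ x : Fin p → I, (∑ i ∈ S, g i (x i)) * ψ k (x j) = ∫ x, g j x * ψ k x :=
    fun k => by rw [integral_additive_mul h S g (h.memLp k) j, if_pos hj]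
  simp_rw [e]
  linarith [h.integral_sq_sub_le (hg j hj) N]

end

/-! ### Truncation levels and the adaptation cost -/

section
variable {μ : ℕ → ℝ} {n p : ℕ}

theorem logTerm_pos {a : ℝ} {s : ℕ} (hp : 1 ≤ p) (ha : 0 < a) (hs : 1 ≤ s) :
    0 < logTerm p a s := by
  have h1 : (0 : ℝ) < p := by exact_mod_cast hp
  have h2 : (0 : ℝ) < s := by exact_mod_cast hs
  refine Real.log_pos ?_
  have : 0 < p * a / (s : ℝ) ^ 2 := by positivity
  linarith

theorem logTerm_mono {a b : ℝ} {s : ℕ} (ha : 0 < a) (hab : a ≤ b) :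
    logTerm p a s ≤ logTerm p b s := by
  unfold logTerm
  gcongr

/-- The defining set is nonempty, so the infimum is attained: eigenvalues are at most 1 while `√(ν
L) / n` is unbounded in `ν`. -/
theorem nuH_spec {a : ℝ} {s : ℕ} (hμ : ∀ k, μ k ≤ 1) (hn : 1 ≤ n) (hp : 1 ≤ p) (ha : 0 < a)
    (hs : 1 ≤ s) :
    1 ≤ nuH μ n p s a ∧ μ (nuH μ n p s a - 1) ≤ √(nuH μ n p s a * logTerm p a s) / n := by
  have hL := logTerm_pos hp ha hs
  have hn0 : (0 : ℝ) < n := by exact_mod_cast hn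
  refine Nat.sInf_mem (s := {ν : ℕ | 1 ≤ ν ∧ μ (ν - 1) ≤ √(ν * logTerm p a s) / n}) ?_
  obtain ⟨N, hN⟩ := exists_nat_ge ((n : ℝ) ^ 2 / logTerm p a s)
  rw [div_le_iff₀ hL] at hN
  refine ⟨N + 1, by omega, (hμ _).trans ?_⟩
  rw [one_le_div hn0]
  refine Real.le_sqrt_of_sq_le ?_
  push_cast
  nlinarith

/-- Right-continuity in `a`. The finitely many strict failures below the minimum persist by
continuity, and the inequality at the minimum only becomes easier as `a` grows. -/
theorem nuH_eventually_eq {a : ℝ} {s : ℕ} (hμ : ∀ k, μ k ≤ 1) (hn : 1 ≤ n) (hp : 1 ≤ p)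
    (ha : 0 < a) (hs : 1 ≤ s) :
    ∀ᶠ b in nhdsWithin a (Set.Ioi a), nuH μ n p s b = nuH μ n p s a := by
  obtain ⟨h1, h2⟩ := nuH_spec hμ hn hp ha hs
  set N := nuH μ n p s a with hN
  have hs0 : (0 : ℝ) < s := by exact_mod_cast hs
  have hp0 : (0 : ℝ) < p := by exact_mod_cast hp
  have hcont : ∀ ν : ℕ, ContinuousAt (fun b => √(ν * logTerm p b s) / n) a := by
    intro ν
    have : ContinuousAt (fun b : ℝ => Real.log (1 + p * b / (s : ℝ) ^ 2)) a := by
      refine ContinuousAt.log (by fun_prop) ?_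
      positivity
    unfold logTerm
    exact ((continuousAt_const.mul this).sqrt).div_const _
  have hfail : ∀ ν ∈ Finset.range N, ∀ᶠ b in nhdsWithin a (Set.Ioi a),
      ¬ (1 ≤ ν ∧ μ (ν - 1) ≤ √(ν * logTerm p b s) / n) := by
    intro ν hν
    by_cases hν1 : 1 ≤ ν
    · have hlt : √(ν * logTerm p a s) / n < μ (ν - 1) := by
        by_contra hc
        exact (Finset.mem_range.1 hν).not_ge (Nat.sInf_le ⟨hν1, not_lt.1 hc⟩)
      have : ∀ᶠ b in nhdsWithin a (Set.Ioi a), √(ν * logTerm p b s) / n < μ (ν - 1) :=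
        ((hcont ν).eventually (eventually_lt_nhds hlt)).filter_mono nhdsWithin_le_nhds
      filter_upwards [this] with b hb hc
      exact absurd hc.2 (not_le.2 hb)
    · exact Filter.Eventually.of_forall fun b hb => hν1 hb.1
  filter_upwards [(Finset.eventually_all _).2 hfail, self_mem_nhdsWithin] with b hb hab
  have hab' : a ≤ b := le_of_lt hab
  refine le_antisymm (Nat.sInf_le ⟨h1, h2.trans ?_⟩) ?_
  · have := logTerm_mono (p := p) (s := s) ha hab'
    gcongr
  · by_contra hc
    exact hb _ (Finset.mem_range.2 (not_le.1 hc)) (nuH_spec hμ hn hp (ha.trans_le hab') hs)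

theorem gridVa_eventually_eq {a : ℝ} (hμ : ∀ k, μ k ≤ 1) (hn : 1 ≤ n) (hp : 1 ≤ p)
    (ha : 0 < a) :
    ∀ᶠ b in nhdsWithin a (Set.Ioi a), gridVa μ n p b = gridVa μ n p a := by
  have h : ∀ s ∈ Finset.Icc 1 p, ∀ᶠ b in nhdsWithin a (Set.Ioi a),
      nuH μ n p s b = nuH μ n p s a := fun s hs =>
    nuH_eventually_eq hμ hn hp ha (Finset.mem_Icc.1 hs).1
  filter_upwards [(Finset.eventually_all _).2 h] with b hb
  ext m
  refine exists_congr fun k => and_congr_right fun _ => exists_congr fun s =>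
    and_congr_right fun hs => ?_
  rw [hb s (Finset.mem_Icc.2 hs)]

theorem dyadic_level_iff {k ν : ℕ} :
    ((2 : ℝ) ^ ((k : ℤ) - 1) < ν ∧ ν ≤ 2 ^ k) ↔ 2 ^ k < 2 * ν ∧ ν ≤ 2 ^ k := by
  rw [zpow_sub_one₀ (by norm_num), zpow_natCast, ← div_eq_mul_inv, div_lt_iff₀ (by norm_num),
    mul_comm (ν : ℝ)]
  norm_cast

/-- Each sparsity contributes exactly one dyadic level. Hence the grid has at most `p` elements and
the adaptation cost is at most `1 + log p`. -/
theorem gridVa_eq_image {a : ℝ} (hμ : ∀ k, μ k ≤ 1) (hn : 1 ≤ n) (hp : 1 ≤ p) (ha : 0 < a) :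
    gridVa μ n p a = (fun s => 2 ^ Nat.clog 2 (nuH μ n p s a)) '' Set.Icc 1 p := by
  have key : ∀ ν k : ℕ, 1 ≤ ν → ((2 ^ k < 2 * ν ∧ ν ≤ 2 ^ k) ↔ Nat.clog 2 ν = k) := by
    intro ν k hν
    have h1 : ν ≤ 2 ^ k ↔ Nat.clog 2 ν ≤ k := (Nat.clog_le_iff_le_pow one_lt_two).symm
    rw [h1]
    rcases k with _ | k
    · simp only [pow_zero, nonpos_iff_eq_zero, and_iff_right_iff_imp]
      omega
    · have h2 : ν ≤ 2 ^ k ↔ Nat.clog 2 ν ≤ k := (Nat.clog_le_iff_le_pow one_lt_two).symm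
      rw [pow_succ]
      omega
  ext m
  constructor
  · rintro ⟨k, rfl, s, hs, hk⟩
    refine ⟨s, hs, ?_⟩
    rw [dyadic_level_iff, key _ _ (nuH_spec hμ hn hp ha hs.1).1] at hk
    simp only [hk]
  · rintro ⟨s, hs, rfl⟩
    refine ⟨_, rfl, s, hs, ?_⟩
    rw [dyadic_level_iff, key _ _ (nuH_spec hμ hn hp ha hs.1).1]

theorem finite_gridVa {a : ℝ} (hμ : ∀ k, μ k ≤ 1) (hn : 1 ≤ n) (hp : 1 ≤ p) (ha : 0 < a) :
    (gridVa μ n p a).Finite := by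
  rw [gridVa_eq_image hμ hn hp ha]
  exact (Set.finite_Icc 1 p).image _

theorem one_le_ncard_gridVa {a : ℝ} (hμ : ∀ k, μ k ≤ 1) (hn : 1 ≤ n) (hp : 1 ≤ p)
    (ha : 0 < a) : 1 ≤ (gridVa μ n p a).ncard := by
  rw [Nat.one_le_iff_ne_zero, ← Nat.pos_iff_ne_zero, Set.ncard_pos (finite_gridVa hμ hn hp ha),
    gridVa_eq_image hμ hn hp ha]
  exact ⟨_, 1, ⟨le_rfl, hp⟩, rfl⟩

theorem ncard_gridVa_le {a : ℝ} (hμ : ∀ k, μ k ≤ 1) (hn : 1 ≤ n) (hp : 1 ≤ p)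
    (ha : 0 < a) : (gridVa μ n p a).ncard ≤ p := by
  rw [gridVa_eq_image hμ hn hp ha]
  refine (Set.ncard_image_le (Set.finite_Icc 1 p)).trans ?_
  rw [← Finset.coe_Icc, Set.ncard_coe_finset]
  simp

theorem log_exp_one_mul {N : ℕ} (hN : 1 ≤ N) : Real.log (Real.exp 1 * N) = 1 + Real.log N := by
  rw [Real.log_mul (Real.exp_pos 1).ne' (by positivity), Real.log_exp]

theorem costA_bddAbove (hμ : ∀ k, μ k ≤ 1) (hn : 1 ≤ n) (hp : 1 ≤ p) :
    1 + Real.log p ∈ upperBounds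
      {a : ℝ | 1 ≤ a ∧ a ≤ Real.log (Real.exp 1 * (gridVa μ n p a).ncard)} := by
  rintro a ⟨h1, h2⟩
  have ha : 0 < a := by linarith
  have hN := one_le_ncard_gridVa hμ hn hp ha
  rw [log_exp_one_mul hN] at h2
  have : Real.log (gridVa μ n p a).ncard ≤ Real.log p := by
    refine Real.log_le_log (by exact_mod_cast hN) ?_
    exact_mod_cast ncard_gridVa_le hμ hn hp ha
  linarith

theorem one_le_costA (hμ : ∀ k, μ k ≤ 1) (hn : 1 ≤ n) (hp : 1 ≤ p) : 1 ≤ costA μ n p := by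
  refine le_csSup ⟨_, costA_bddAbove hμ hn hp⟩ ⟨le_rfl, ?_⟩
  have hN := one_le_ncard_gridVa hμ hn hp one_pos
  rw [log_exp_one_mul hN]
  linarith [Real.log_nonneg (show (1 : ℝ) ≤ (gridVa μ n p 1).ncard by exact_mod_cast hN)]

theorem costA_le (hμ : ∀ k, μ k ≤ 1) (hn : 1 ≤ n) (hp : 1 ≤ p) :
    costA μ n p ≤ 1 + Real.log p := by
  refine csSup_le ⟨1, le_rfl, ?_⟩ (costA_bddAbove hμ hn hp)
  have hN := one_le_ncard_gridVa hμ hn hp one_pos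
  rw [log_exp_one_mul hN]
  linarith [Real.log_nonneg (show (1 : ℝ) ≤ (gridVa μ n p 1).ncard by exact_mod_cast hN)]

theorem costA_le_self (hμ : ∀ k, μ k ≤ 1) (hn : 1 ≤ n) (hp : 1 ≤ p) : costA μ n p ≤ p := by
  have := Real.log_le_sub_one_of_pos (show (0 : ℝ) < p by exact_mod_cast hp)
  linarith [costA_le (μ := μ) hμ hn hp]

/-- The number of truncation levels in the grid is at most exponential in the adaptation cost. -/
theorem ncard_gridV_le (hμ : ∀ k, μ k ≤ 1) (hn : 1 ≤ n) (hp : 1 ≤ p) :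
    ((gridV μ n p).ncard : ℝ) ≤ Real.exp (costA μ n p - 1) := by
  have hA := one_le_costA hμ hn hp
  have hN : 1 ≤ (gridV μ n p).ncard := one_le_ncard_gridVa hμ hn hp (by linarith)
  have hN0 : (0 : ℝ) < (gridV μ n p).ncard := by exact_mod_cast hN
  -- The supremum need not be attained, so the bound is read off just to its right: there the grid
  -- is unchanged and the defining inequality fails.
  have hev : ∀ᶠ b in nhdsWithin (costA μ n p) (Set.Ioi (costA μ n p)),
      1 + Real.log (gridV μ n p).ncard ≤ b := by
    filter_upwards [gridVa_eventually_eq hμ hn hp (show 0 < costA μ n p by linarith),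
      self_mem_nhdsWithin] with b hb hab
    have hab' : costA μ n p < b := hab
    by_contra hc
    refine absurd (le_csSup ⟨_, costA_bddAbove hμ hn hp⟩ ⟨by linarith, ?_⟩) (not_le.2 hab')
    rw [hb, ← log_exp_one_mul hN] at *
    exact (not_le.1 hc).le
  have hle : 1 + Real.log (gridV μ n p).ncard ≤ costA μ n p :=
    ge_of_tendsto (Filter.tendsto_id.mono_left nhdsWithin_le_nhds) hev
  rw [← Real.log_le_iff_le_exp hN0]
  linarith

theorem one_le_of_mem_gridV {ν : ℕ} (h : ν ∈ gridV μ n p) : 1 ≤ ν := by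
  obtain ⟨k, rfl, _⟩ := h
  exact Nat.one_le_two_pow

theorem exists_mem_gridV (hμ : ∀ k, μ k ≤ 1) (hn : 1 ≤ n) (hp : 1 ≤ p) {s : ℕ} (hs1 : 1 ≤ s)
    (hsp : s ≤ p) : ∃ ν ∈ gridV μ n p, nuH μ n p s (costA μ n p) ≤ ν ∧
      ν ≤ 2 * nuH μ n p s (costA μ n p) := by
  have hA := one_le_costA hμ hn hp
  have hmem : 2 ^ Nat.clog 2 (nuH μ n p s (costA μ n p)) ∈ gridV μ n p := by
    rw [gridV, gridVa_eq_image hμ hn hp (by linarith)]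
    exact ⟨s, ⟨hs1, hsp⟩, rfl⟩
  refine ⟨_, hmem, Nat.le_pow_clog one_lt_two _, ?_⟩
  have hν := (nuH_spec hμ hn hp (show 0 < costA μ n p by linarith) hs1).1
  rcases Nat.lt_or_ge 1 (nuH μ n p s (costA μ n p)) with h1 | h1
  · have h2 := Nat.pow_pred_clog_lt_self one_lt_two h1
    have h3 : 0 < Nat.clog 2 (nuH μ n p s (costA μ n p)) := Nat.clog_pos one_lt_two h1
    obtain ⟨m, hm⟩ := Nat.exists_eq_succ_of_ne_zero h3.ne'
    rw [hm] at h2 ⊢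
    rw [Nat.pow_succ]
    simp only [Nat.pred_succ] at h2
    omega
  · have : nuH μ n p s (costA μ n p) = 1 := le_antisymm h1 hν
    simp [this]

/-! ### The grid of sparsities -/

/-- Places the grid point `s = p` in the dense regime. -/
theorem sqrt_mul_costA_le (hμ : ∀ k, μ k ≤ 1) (hn : 1 ≤ n) (hp : 1 ≤ p) :
    √(p * costA μ n p) ≤ p := by
  rw [Real.sqrt_le_left (Nat.cast_nonneg _), sq]
  exact mul_le_mul_of_nonneg_left (costA_le_self hμ hn hp) (Nat.cast_nonneg _)

theorem two_pow_lt_sqrt_iff {k : ℕ} {x : ℝ} (hx : 0 < x) :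
    (k : ℤ) ≤ ⌈Real.logb 2 x⌉ - 1 ↔ (2 : ℝ) ^ k < x := by
  rw [Int.le_sub_one_iff, Int.lt_ceil, Int.cast_natCast, Real.lt_logb_iff_rpow_lt one_lt_two hx,
    Real.rpow_natCast]

theorem mem_gridS_iff (hμ : ∀ k, μ k ≤ 1) (hn : 1 ≤ n) (hp : 1 ≤ p) {s : ℕ} :
    s ∈ gridS μ n p ↔ (∃ k : ℕ, (2 : ℝ) ^ k < √(p * costA μ n p) ∧ s = 2 ^ k) ∨ s = p := by
  have hA := one_le_costA hμ hn hp
  have hp0 : (0 : ℝ) < p := by exact_mod_cast hp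
  have hx : 0 < √(p * costA μ n p) := Real.sqrt_pos.2 (by positivity)
  simp only [gridS, Set.mem_union, Set.mem_ofPred_eq, Set.mem_singleton_iff,
    two_pow_lt_sqrt_iff hx]

theorem exists_mem_gridS (hμ : ∀ k, μ k ≤ 1) (hn : 1 ≤ n) (hp : 1 ≤ p) {s : ℕ} (hs1 : 1 ≤ s)
    (hs : (s : ℝ) < √(p * costA μ n p)) :
    ∃ r ∈ gridS μ n p, 1 ≤ r ∧ r ≤ s ∧ s ≤ 2 * r := by
  have h1 : 2 ^ Nat.log 2 s ≤ s := Nat.pow_log_le_self 2 (by omega)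
  have h2 : s < 2 ^ (Nat.log 2 s + 1) := Nat.lt_pow_succ_log_self one_lt_two s
  refine ⟨2 ^ Nat.log 2 s, (mem_gridS_iff hμ hn hp).2 (Or.inl ⟨_, ?_, rfl⟩), Nat.one_le_two_pow,
    h1, ?_⟩
  · refine lt_of_le_of_lt ?_ hs
    exact_mod_cast h1
  · rw [pow_succ] at h2
    omega

theorem sum_four_pow_le {F : Finset ℕ} {B : ℝ} (hB : 0 ≤ B) (hF : ∀ k ∈ F, (4 : ℝ) ^ k ≤ B) :
    ∑ k ∈ F, (4 : ℝ) ^ k ≤ 4 / 3 * B := by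
  rcases F.eq_empty_or_nonempty with rfl | hne
  · simpa using by linarith
  set K := F.max' hne
  have hsub : F ⊆ Finset.range (K + 1) := fun k hk =>
    Finset.mem_range.2 (Nat.lt_succ_of_le (F.le_max' k hk))
  refine (Finset.sum_le_sum_of_subset_of_nonneg hsub fun _ _ _ => by positivity).trans ?_
  rw [geom_sum_eq (by norm_num), pow_succ]
  have := hF K (F.max'_mem hne)
  linarith

end

/-! ### The threshold regime -/

/-- The scale `√(d L) ∨ L` of the thresholds. -/
noncomputable def thrScale (d : ℕ) (L : ℝ) : ℝ := max √(d * L) L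

section
variable {d : ℕ} {L : ℝ}

theorem le_thrScale : L ≤ thrScale d L := le_max_right _ _

theorem mul_le_thrScale_sq (hL : 0 ≤ L) : d * L ≤ thrScale d L ^ 2 := by
  rw [← Real.sq_sqrt (show 0 ≤ d * L by positivity)]
  exact pow_le_pow_left₀ (Real.sqrt_nonneg _) (le_max_left _ _) 2

theorem thrScale_pos (hL : 1 / 2 ≤ L) : 0 < thrScale d L :=
  lt_of_lt_of_le (by linarith) le_thrScale

theorem card_lt_threshold (hL : 1 / 2 ≤ L) :
    (Fintype.card (Fin d) : ℝ) < d + 9 * thrScale d L := by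
  have := thrScale_pos (d := d) hL
  rw [Fintype.card_fin]
  linarith

theorem card_le_thrScale_sq (hL : 1 / 2 ≤ L) : (d : ℝ) ≤ 2 * thrScale d L ^ 2 := by
  have := mul_le_thrScale_sq (d := d) (L := L) (by linarith)
  have hd : (0 : ℝ) ≤ d := Nat.cast_nonneg d
  nlinarith

theorem chiTail_threshold_le (hd : 1 ≤ d) (hL : 1 / 2 ≤ L) :
    chiTail (Fin d) (d + 9 * thrScale d L) ≤ Real.exp (-L) := by
  have h := chiTail_le_exp_neg (ι := Fin d) (x := L) (y := 9 * thrScale d L)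
    (by rw [Fintype.card_fin]; omega) (by linarith)
  rw [Fintype.card_fin] at h
  refine h ?_
  have h1 : √(d * L) ≤ thrScale d L := le_max_left _ _
  have h2 : L ≤ thrScale d L := le_thrScale
  have := thrScale_pos (d := d) hL
  linarith

/-- Both `d L` and `L q` are at most `q²`, where `q` is the scale; this bounds the denominator `2 (d
+ 9q)` of the rate. -/
theorem le_tailRate_mul_thrScale (hL : 1 / 2 ≤ L) :
    L / 3 ≤ tailRate (Fin d) (d + 9 * thrScale d L) * thrScale d L := by
  have h0 := thrScale_pos (d := d) hL
  have h1 := mul_le_thrScale_sq (d := d) (L := L) (by linarith)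
  have h2 : L ≤ thrScale d L := le_thrScale
  have hd : (0 : ℝ) ≤ d := Nat.cast_nonneg d
  rw [tailRate, Fintype.card_fin, add_sub_cancel_left, div_mul_eq_mul_div,
    div_le_div_iff₀ (by norm_num) (by positivity)]
  nlinarith

theorem condMean_threshold_le (hd : 1 ≤ d) (hL : 1 / 2 ≤ L) :
    condMean (Fin d) (d + 9 * thrScale d L) ≤ d + 21 * thrScale d L := by
  have : Nonempty (Fin d) := ⟨⟨0, hd⟩⟩
  have h0 := thrScale_pos (d := d) hL
  have h1 := tailRate_mul_condMean_sub_le (ι := Fin d) (card_lt_threshold (d := d) hL)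
  have h2 := le_tailRate_mul_thrScale (d := d) hL
  have h3 := le_condMean (ι := Fin d) (card_lt_threshold (d := d) hL)
  have h4 := tailRate_pos (ι := Fin d) (card_lt_threshold (d := d) hL)
  set w := condMean (Fin d) (d + 9 * thrScale d L) - (d + 9 * thrScale d L) with hw
  set l := tailRate (Fin d) (d + 9 * thrScale d L)
  have h5 : l * w ≤ 2 := by linarith
  have h6 : 1 / 6 ≤ l * thrScale d L := by linarith
  have h7 : w ≤ 12 * thrScale d L := by
    refine le_of_mul_le_mul_left ?_ h4
    linarith
  linarith

/-- Holds whether or not the threshold is passed: below it the left side is negative. Signal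
coordinates thus need no separate analysis of which ones survive. -/
theorem sub_condMean_le_thresh (hd : 1 ≤ d) (hL : 1 / 2 ≤ L) (e : ℝ) :
    e - (d + 21 * thrScale d L) ≤ thresh (Fin d) (d + 9 * thrScale d L) e := by
  have : Nonempty (Fin d) := ⟨⟨0, hd⟩⟩
  have h1 := condMean_threshold_le hd hL
  have h2 := le_condMean (ι := Fin d) (card_lt_threshold (d := d) hL)
  unfold thresh
  split_ifs with he
  · linarith
  · push Not at he; linarith

end

/-! ### The tests in terms of the threshold scale -/

theorem dLevel_one {ν : ℕ} (hν : 1 ≤ ν) : dLevel 1 ν = ν := by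
  simp [dLevel, hν]

theorem thresholdStat_eq {p : ℕ} (n : ℕ) (X : ℕ → Fin p → ℝ) (r : ℝ) (d : ℕ) :
    thresholdStat n X r d = ∑ j, thresh (Fin d) (d + r ^ 2) (energy n X d j) := rfl

/-- With `K₃ = 1` the switch between bulk and tail occurs exactly where `√(ν L)` and `L` cross, and
`3² = 9` is the common threshold factor. -/
theorem phi_eq_one_iff_sparse {μ : ℕ → ℝ} {n p : ℕ} {C : ℝ} {X : ℕ → Fin p → ℝ} {ν s : ℕ}
    (hν : 1 ≤ ν) (hL : 0 ≤ logTerm p (costA μ n p) s) (hs : (s : ℝ) < √(p * costA μ n p)) :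
    phi μ n p 1 3 3 1 C X ν s = 1 ↔
      C * s * thrScale ν (logTerm p (costA μ n p) s)
        < ∑ j, thresh (Fin ν) (ν + 9 * thrScale ν (logTerm p (costA μ n p) s))
          (energy n X ν j) := by
  have hν0 : (0 : ℝ) ≤ ν := Nat.cast_nonneg ν
  rw [phi, if_pos hs, dLevel_one hν, one_mul]
  set L := logTerm p (costA μ n p) s with hLdef
  by_cases hc : √L ≤ √ν
  · have hLν : L ≤ ν := (Real.sqrt_le_sqrt_iff hν0).1 hc
    have hq : thrScale ν L = √(ν * L) := by
      refine max_eq_left (Real.le_sqrt_of_sq_le ?_)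
      rw [sq]
      exact mul_le_mul_of_nonneg_right hLν hL
    have hr : rBulk μ n p 1 3 ν s ^ 2 = 9 * √(ν * L) := by
      rw [rBulk, dLevel_one hν, mul_pow, ← hLdef, ← Real.rpow_natCast (_ ^ _),
        ← Real.rpow_mul (by positivity), Real.sqrt_eq_rpow]
      norm_num
    rw [if_pos hc, thresholdStat_eq, hr, hq]
    simp
  · have hLν : (ν : ℝ) ≤ L := by
      by_contra h
      exact hc (Real.sqrt_le_sqrt (not_le.1 h).le)
    have hq : thrScale ν L = L := by
      refine max_eq_right (Real.sqrt_le_iff.2 ⟨hL, ?_⟩)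
      rw [sq]
      exact mul_le_mul_of_nonneg_right hLν hL
    have hr : rTail μ n p 3 s ^ 2 = 9 * L := by
      rw [rTail, mul_pow, Real.sq_sqrt hL]; norm_num
    rw [if_neg hc, thresholdStat_eq, hr, hq]
    simp

theorem phi_eq_one_iff_dense {μ : ℕ → ℝ} {n p : ℕ} {D K₂ K₂' K₃ C : ℝ} {X : ℕ → Fin p → ℝ}
    {ν s : ℕ} (hs : ¬ (s : ℝ) < √(p * costA μ n p)) :
    phi μ n p D K₂ K₂' K₃ C X ν s = 1 ↔
      ν * p + C * √(ν * p * costA μ n p) < ∑ j, energy n X ν j := by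
  rw [phi, if_neg hs]
  simp [energy, Finset.mul_sum]

theorem scanTest_eq_one_iff {μ : ℕ → ℝ} {n p : ℕ} {D K₂ K₂' K₃ C : ℝ} {X : ℕ → Fin p → ℝ} :
    scanTest μ n p D K₂ K₂' K₃ C X = 1 ↔
      ∃ ν ∈ gridV μ n p, ∃ s ∈ gridS μ n p, phi μ n p D K₂ K₂' K₃ C X ν s = 1 := by
  unfold scanTest
  split_ifs with h <;> simp [h]

theorem scanTest_ne_zero_iff {μ : ℕ → ℝ} {n p : ℕ} {D K₂ K₂' K₃ C : ℝ} {X : ℕ → Fin p → ℝ} :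
    scanTest μ n p D K₂ K₂' K₃ C X ≠ 0 ↔
      ∃ ν ∈ gridV μ n p, ∃ s ∈ gridS μ n p, phi μ n p D K₂ K₂' K₃ C X ν s = 1 := by
  unfold scanTest
  split_ifs with h <;> simp [h]

/-! ### Sparsity levels below `√(p A)` -/

section
variable {p s : ℕ} {A : ℝ}

theorem sq_lt_of_lt_sqrt (hs : (s : ℝ) < √(p * A)) : (s : ℝ) ^ 2 < p * A := by
  rwa [Real.lt_sqrt (Nat.cast_nonneg s)] at hs

theorem half_le_logTerm (hs1 : 1 ≤ s) (hs : (s : ℝ) < √(p * A)) : 1 / 2 ≤ logTerm p A s := by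
  have hs0 : (0 : ℝ) < s := by exact_mod_cast hs1
  have h : 1 < p * A / (s : ℝ) ^ 2 := (one_lt_div (by positivity)).2 (sq_lt_of_lt_sqrt hs)
  have h2 : Real.log 2 ≤ logTerm p A s := Real.log_le_log (by norm_num) (by linarith)
  linarith [Real.log_two_gt_d9]

theorem exp_neg_logTerm_le (hp : 1 ≤ p) (hA : 1 ≤ A) (hs1 : 1 ≤ s) :
    Real.exp (-logTerm p A s) ≤ (s : ℝ) ^ 2 / (p * A) := by
  have hs0 : (0 : ℝ) < s := by exact_mod_cast hs1
  have hp0 : (0 : ℝ) < p := by exact_mod_cast hp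
  have hu : 0 < p * A / (s : ℝ) ^ 2 := by positivity
  rw [logTerm, Real.exp_neg, Real.exp_log (by linarith), ← inv_div (p * A)]
  gcongr
  linarith

/-- For `s ≤ A`, Bernoulli's inequality gives `(1 + pA / s²)^s ≥ 1 + p`, so `s L ≥ log (1 + p)`,
which controls `A ≤ 1 + log p`. For `s ≥ A`, `L ≥ 1/2` suffices. -/
theorem le_three_mul_min_mul_logTerm (hp : 1 ≤ p) (hA : 1 ≤ A) (hAp : A ≤ 1 + Real.log p)
    (hs1 : 1 ≤ s) (hs : (s : ℝ) < √(p * A)) : A ≤ 3 * (min (s : ℝ) A * logTerm p A s) := by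
  have hL := half_le_logTerm hs1 hs
  have hs0 : (0 : ℝ) < s := by exact_mod_cast hs1
  have hp0 : (0 : ℝ) < p := by exact_mod_cast hp
  rcases le_total (s : ℝ) A with h | h
  · rw [min_eq_left h]
    have h1 : Real.log (1 + p) ≤ s * logTerm p A s := by
      rw [logTerm, ← Real.log_pow]
      refine Real.log_le_log (by positivity) ?_
      have h2 : (p : ℝ) / s ≤ p * A / (s : ℝ) ^ 2 := by
        rw [div_le_div_iff₀ hs0 (by positivity)]
        nlinarith [mul_nonneg hp0.le (mul_nonneg hs0.le (sub_nonneg.2 h))]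
      have h3 := one_add_mul_le_pow (show (-2 : ℝ) ≤ p / s by
        linarith [div_pos hp0 hs0]) s
      rw [mul_div_cancel₀ _ hs0.ne'] at h3
      refine h3.trans (pow_le_pow_left₀ (by positivity) (by linarith) s)
    have h4 : Real.log p ≤ Real.log (1 + p) := Real.log_le_log hp0 (by linarith)
    have h5 : Real.log 2 ≤ Real.log (1 + p) := by
      refine Real.log_le_log (by norm_num) ?_
      have : (1 : ℝ) ≤ p := by exact_mod_cast hp
      linarith
    linarith [Real.log_two_gt_d9]
  · rw [min_eq_right h]
    nlinarith

end

section
variable {H : Type*} [NormedAddCommGroup H] [InnerProductSpace ℝ H] [CompleteSpace H]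
  [RKHS ℝ H I ℝ] {μ : ℕ → ℝ} {ψ : ℕ → I → ℝ} {n p : ℕ} {Ω : Type*} [MeasurableSpace Ω]
  {P : Measure Ω} {Y : ((Fin p → I) → ℝ) → Ω → ℝ} {f : (Fin p → I) → ℝ}

/-- Deviations, in both directions, of the thresholded statistic over pure noise coordinates. -/
theorem measure_sum_thresh_noise_le (h : IsEigensystem H μ ψ) (hw : IsWhiteNoise n f P Y)
    (hn : 1 ≤ n) (hp : 1 ≤ p) {A C t : ℝ} (hA : 1 ≤ A) (hAp : A ≤ 1 + Real.log p)
    {s ν : ℕ} (hs1 : 1 ≤ s) (hs : (s : ℝ) < √(p * A)) (hν : 1 ≤ ν) (ht : 0 ≤ t)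
    (hC : 300 + 48 * t ≤ C) {J : Finset (Fin p)}
    (hJ : ∀ j ∈ J, ∀ k, ∫ x : Fin p → I, f x * ψ k (x j) = 0) {ε : ℝ} (hε : |ε| = 1) :
    P.real {ω | C * s * thrScale ν (logTerm p A s)
        ≤ ε * ∑ j ∈ J, thresh (Fin ν) (ν + 9 * thrScale ν (logTerm p A s))
          (energy n (seqData ψ Y ω) ν j)}
      ≤ Real.exp (-(t * (A + logTerm p A s))) := by
  have := hw.gaussian.isProbabilityMeasure
  have : Nonempty (Fin ν) := ⟨⟨0, hν⟩⟩
  have hs0 : (0 : ℝ) < s := by exact_mod_cast hs1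
  have hs1' : (1 : ℝ) ≤ s := by exact_mod_cast hs1
  have hp0 : (0 : ℝ) < p := by exact_mod_cast hp
  have hL := half_le_logTerm hs1 hs
  have hmin := le_three_mul_min_mul_logTerm hp hA hAp hs1 hs
  have hexp := exp_neg_logTerm_le hp hA hs1
  set L := logTerm p A s
  set q := thrScale ν L with hq
  set m := min (s : ℝ) A with hm
  have hm1 : 1 ≤ m := le_min hs1' hA
  have hms : m ≤ s := min_le_left _ _
  have hmA : m ≤ A := min_le_right _ _
  have hx := card_lt_threshold (d := ν) hL
  have hq0 : 0 < q := thrScale_pos hL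
  set l := tailRate (Fin ν) (ν + 9 * q) with hl
  have hl0 : 0 < l := tailRate_pos hx
  have hlq : L / 3 ≤ l * q := le_tailRate_mul_thrScale hL
  -- The Chernoff parameter: `m ≤ s` keeps it at most 1/4. The variance term, of order `m² / A`, is
  -- then at most of order `m`, while the linear gain is of order `C m L` and so pays for both `A`
  -- and `L`.
  set k := m / (4 * s) with hk
  have hk0 : 0 < k := by positivity
  have hk4 : k ≤ 1 / 4 := by
    rw [hk, div_le_div_iff₀ (by positivity) (by norm_num)]; linarith
  have hcher := measure_sum_thresh_ge_le (k := ε * k) (x := ν + 9 * q)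
    (iIndepFun_normData_block h hw hn ν)
    (fun j => aemeasurable_pi_lambda _ fun i => (hasLaw_normData h hw hn (j, (i : ℕ))).aemeasurable)
    J (fun j hj => hasLaw_normData_block h hw hn ν j (hJ j hj)) hx
    (by rw [abs_mul, hε, one_mul, abs_of_pos hk0]; exact hk4) (k * l * (C * s * q))
  have hsub : {ω | C * s * q ≤ ε * ∑ j ∈ J, thresh (Fin ν) (ν + 9 * q)
        (energy n (seqData ψ Y ω) ν j)}
      ⊆ {ω | k * l * (C * s * q) ≤ ε * k * l * ∑ j ∈ J, thresh (Fin ν) (ν + 9 * q)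
          (∑ i : Fin ν, normData n ψ Y j i ω ^ 2)} := by
    intro ω hω
    simp only [Set.mem_ofPred_eq, sum_normData_sq] at hω ⊢
    have := mul_le_mul_of_nonneg_left hω (mul_pos hk0 hl0).le
    linarith
  refine (measureReal_mono hsub).trans (hcher.trans (Real.exp_le_exp.2 ?_))
  have hε2 : (ε * k) ^ 2 = k ^ 2 := by rw [mul_pow, ← sq_abs ε, hε]; ring
  rw [hε2]
  have hcard : (J.card : ℝ) ≤ p := by
    have := J.card_le_univ
    rw [Fintype.card_fin] at this
    exact_mod_cast this
  have hvar : 200 * J.card * chiTail (Fin ν) (ν + 9 * q) * k ^ 2 ≤ 25 * (m * L) := by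
    have h1 : chiTail (Fin ν) (ν + 9 * q) ≤ (s : ℝ) ^ 2 / (p * A) :=
      (chiTail_threshold_le hν hL).trans hexp
    have h0 := chiTail_nonneg (ι := Fin ν) (ν + 9 * q)
    calc 200 * J.card * chiTail (Fin ν) (ν + 9 * q) * k ^ 2
        ≤ 200 * p * ((s : ℝ) ^ 2 / (p * A)) * k ^ 2 := by gcongr
      _ = 12.5 * (m * (m / A)) := by rw [hk]; field_simp; norm_num
      _ ≤ 12.5 * (m * 1) := by
          have : m / A ≤ 1 := (div_le_one (by linarith)).2 hmA
          gcongr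
      _ ≤ 25 * (m * L) := by nlinarith
  have hlin : C / 12 * (m * L) ≤ k * l * (C * s * q) := by
    have e : k * l * (C * s * q) = C / 4 * m * (l * q) := by rw [hk]; field_simp
    rw [e]
    have : 0 ≤ C / 4 * m := by
      have : 0 ≤ C := by linarith
      positivity
    nlinarith [mul_le_mul_of_nonneg_left hlq this]
  have hmL : L ≤ m * L := le_mul_of_one_le_left (by linarith) hm1
  have h4 : t * (A + L) ≤ t * (4 * (m * L)) := mul_le_mul_of_nonneg_left (by linarith) ht
  have h5 : (25 + 4 * t) * (m * L) ≤ C / 12 * (m * L) :=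
    mul_le_mul_of_nonneg_right (by linarith) (by linarith)
  nlinarith

/-- Deviations of the total energy over pure noise. -/
theorem measure_total_energy_noise_le (h : IsEigensystem H μ ψ) (hw : IsWhiteNoise n f P Y)
    (hn : 1 ≤ n) (hp : 1 ≤ p) {A C t : ℝ} (hA : 1 ≤ A) (hAp : A ≤ p)
    {ν : ℕ} (hν : 1 ≤ ν) (ht : 1 ≤ t) (hC : 6 * t ≤ C)
    (hf : ∀ j k, ∫ x : Fin p → I, f x * ψ k (x j) = 0) :
    P.real {ω | ν * p + C * √(ν * p * A) < ∑ j, energy n (seqData ψ Y ω) ν j}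
      ≤ Real.exp (-(t * A)) := by
  have := hw.gaussian.isProbabilityMeasure
  have hν1 : (1 : ℝ) ≤ ν := by exact_mod_cast hν
  have hp1 : (1 : ℝ) ≤ p := by exact_mod_cast hp
  have hlaw : HasLaw (fun ω (a : Fin p × Fin ν) => normData n ψ Y a.1 a.2 ω)
      (stdGaussian (Fin p × Fin ν)) P := by
    have h1 : ∀ a : Fin p × Fin ν, HasLaw (normData n ψ Y a.1 a.2) (gaussianReal 0 1) P :=
      fun a => by simpa [hf] using hasLaw_normData h hw hn (a.1, (a.2 : ℕ))
    have hm : ∀ a : Fin p × Fin ν, AEMeasurable (normData n ψ Y a.1 a.2) P :=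
      fun a => (h1 a).aemeasurable
    have hind : iIndepFun (fun (a : Fin p × Fin ν) => normData n ψ Y a.1 a.2) P :=
      (iIndepFun_normData h hw hn).precomp (g := fun a : Fin p × Fin ν => (a.1, (a.2 : ℕ)))
        fun a b hab => by simpa [Prod.ext_iff, Fin.ext_iff] using hab
    refine ⟨aemeasurable_pi_lambda _ hm, ?_⟩
    refine ((iIndepFun_iff_map_fun_eq_pi_map hm).1 hind).trans ?_
    exact congrArg Measure.pi (funext fun k => (h1 k).map_eq)
  have hsum : ∀ ω, ∑ j, energy n (seqData ψ Y ω) ν j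
      = ∑ a : Fin p × Fin ν, normData n ψ Y a.1 a.2 ω ^ 2 := fun ω => by
    rw [Fintype.sum_prod_type]
    exact Finset.sum_congr rfl fun j _ => (sum_normData_sq n ψ Y j ν ω).symm
  have hcard : (Fintype.card (Fin p × Fin ν) : ℝ) = ν * p := by
    simp [mul_comm]
  have hchi := chiTail_le_exp_neg (ι := Fin p × Fin ν) (x := t * A) (y := C * √(ν * p * A))
    (by simp; omega) (by positivity)
  rw [hcard] at hchi
  have hset := hlaw.measureReal_eq (measurableSet_le_sumSq (ν * p + C * √(ν * p * A)))
  calc _ ≤ P.real {ω | ν * p + C * √(ν * p * A)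
        ≤ ∑ a : Fin p × Fin ν, normData n ψ Y a.1 a.2 ω ^ 2} := by
        refine measureReal_mono fun ω hω => ?_
        simp only [Set.mem_ofPred_eq, hsum] at hω ⊢
        exact hω.le
    _ = chiTail (Fin p × Fin ν) (ν * p + C * √(ν * p * A)) := hset
    _ ≤ _ := by
        refine hchi ?_
        have h1 : √(ν * p * (t * A)) ≤ t * √(ν * p * A) := by
          rw [Real.sqrt_le_left (by positivity), mul_pow, Real.sq_sqrt (by positivity)]
          have : 0 ≤ ν * p * A := by positivity
          nlinarith [mul_nonneg (mul_nonneg (show 0 ≤ t by linarith) (sub_nonneg.2 ht)) this]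
        -- Since `A ≤ p ≤ ν p`, the linear chi-square term is absorbed by the square-root term.
        have h2 : A ≤ √(ν * p * A) := by
          refine Real.le_sqrt_of_sq_le ?_
          rw [sq]
          refine mul_le_mul_of_nonneg_right ?_ (by linarith)
          nlinarith
        have h3 : t * A ≤ t * √(ν * p * A) := mul_le_mul_of_nonneg_left h2 (by linarith)
        have h4 : 6 * t * √(ν * p * A) ≤ C * √(ν * p * A) :=
          mul_le_mul_of_nonneg_right hC (Real.sqrt_nonneg _)
        linarith

end

/-! ### The two error probabilities -/

section
variable {H : Type*} [NormedAddCommGroup H] [InnerProductSpace ℝ H] [CompleteSpace H]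
  [RKHS ℝ H I ℝ] {μ : ℕ → ℝ} {ψ : ℕ → I → ℝ} {n p : ℕ} {Ω : Type*} [MeasurableSpace Ω]
  {P : Measure Ω} {Y : ((Fin p → I) → ℝ) → Ω → ℝ} {f : (Fin p → I) → ℝ}

theorem measure_phi_sparse_noise_le (h : IsEigensystem H μ ψ) (hw : IsWhiteNoise n 0 P Y)
    (hn : 1 ≤ n) (hp : 1 ≤ p) {C t : ℝ} (ht : 0 ≤ t) (hC : 300 + 48 * t ≤ C) {ν s : ℕ}
    (hν : 1 ≤ ν) (hs1 : 1 ≤ s) (hs : (s : ℝ) < √(p * costA μ n p)) :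
    P.real {ω | phi μ n p 1 3 3 1 C (seqData ψ Y ω) ν s = 1}
      ≤ Real.exp (-(t * (costA μ n p + logTerm p (costA μ n p) s))) := by
  have := hw.gaussian.isProbabilityMeasure
  have hA := one_le_costA (μ := μ) h.eigenvalue_le_one hn hp
  have hL := half_le_logTerm hs1 hs
  refine le_trans (measureReal_mono fun ω hω => ?_) (measure_sum_thresh_noise_le h hw hn hp hA
    (costA_le h.eigenvalue_le_one hn hp) hs1 hs hν ht hC (J := Finset.univ) (ε := 1)
    (fun j _ k => by simp) abs_one)
  simp only [Set.mem_ofPred_eq, one_mul] at hω ⊢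
  exact ((phi_eq_one_iff_sparse hν (by linarith) hs).1 hω).le

theorem sum_exp_neg_logTerm_le {A : ℝ} (hp : 1 ≤ p) (hA : 1 ≤ A) {F : Finset ℕ}
    (hF : ∀ k ∈ F, (2 : ℝ) ^ k < √(p * A)) :
    ∑ k ∈ F, Real.exp (-logTerm p A (2 ^ k)) ≤ 4 / 3 := by
  have hp0 : (0 : ℝ) < p := by exact_mod_cast hp
  have hB : 0 < p * A := by positivity
  have h4 : ∀ k : ℕ, ((2 : ℝ) ^ k) ^ 2 = 4 ^ k := fun k => by
    rw [← pow_mul, mul_comm, pow_mul]; norm_num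
  calc _ ≤ ∑ k ∈ F, (4 : ℝ) ^ k / (p * A) := by
        refine Finset.sum_le_sum fun k _ => ?_
        have := exp_neg_logTerm_le hp hA (Nat.one_le_two_pow (n := k))
        push_cast at this
        rwa [h4] at this
    _ ≤ _ := by
        rw [← Finset.sum_div, div_le_iff₀ hB]
        refine sum_four_pow_le hB.le fun k hk => ?_
        have := sq_lt_of_lt_sqrt (p := p) (A := A) (s := 2 ^ k) (by exact_mod_cast hF k hk)
        push_cast at this
        rw [h4] at this
        exact this.le

/-- Union bound. Each truncation level costs `exp (-tA)` for the dense test and `4/3` of that for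
all sparse tests together. -/
theorem measure_scanTest_noise_le (h : IsEigensystem H μ ψ) (hw : IsWhiteNoise n 0 P Y)
    (hn : 1 ≤ n) (hp : 1 ≤ p) {C t : ℝ} (ht : 1 ≤ t) (hC : 300 + 48 * t ≤ C) :
    P.real {ω | scanTest μ n p 1 3 3 1 C (seqData ψ Y ω) ≠ 0} ≤ Real.exp (-(t - 1)) := by
  have := hw.gaussian.isProbabilityMeasure
  have hμ := h.eigenvalue_le_one
  set A := costA μ n p with hAdef
  have hA : 1 ≤ A := one_le_costA hμ hn hp
  have hp0 : (0 : ℝ) < p := by exact_mod_cast hp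
  have hfin : (gridV μ n p).Finite := finite_gridVa hμ hn hp (by linarith)
  -- The range `k < p` omits nothing, because `k < 2^k < √(pA) ≤ p`.
  set F := (Finset.range p).filter fun k => (2 : ℝ) ^ k < √(p * A) with hFdef
  have hF : ∀ k ∈ F, (2 : ℝ) ^ k < √(p * A) := fun k hk => (Finset.mem_filter.1 hk).2
  have hsub : {ω | scanTest μ n p 1 3 3 1 C (seqData ψ Y ω) ≠ 0}
      ⊆ ⋃ ν ∈ hfin.toFinset, ({ω | phi μ n p 1 3 3 1 C (seqData ψ Y ω) ν p = 1} ∪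
        ⋃ k ∈ F, {ω | phi μ n p 1 3 3 1 C (seqData ψ Y ω) ν (2 ^ k) = 1}) := by
    intro ω hω
    obtain ⟨ν, hν, s, hs, hphi⟩ := scanTest_ne_zero_iff.1 hω
    refine Set.mem_iUnion₂.2 ⟨ν, hfin.mem_toFinset.2 hν, ?_⟩
    rcases (mem_gridS_iff hμ hn hp).1 hs with ⟨k, hk, rfl⟩ | rfl
    · refine Or.inr (Set.mem_iUnion₂.2 ⟨k, ?_, hphi⟩)
      refine Finset.mem_filter.2 ⟨Finset.mem_range.2 ?_, hk⟩
      have h1 : ((2 ^ k : ℕ) : ℝ) < p := by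
        push_cast
        exact hk.trans_le (sqrt_mul_costA_le hμ hn hp)
      exact Nat.lt_two_pow_self.trans (by exact_mod_cast h1)
    · exact Or.inl hphi
  have hν : ∀ ν ∈ hfin.toFinset, P.real ({ω | phi μ n p 1 3 3 1 C (seqData ψ Y ω) ν p = 1} ∪
        ⋃ k ∈ F, {ω | phi μ n p 1 3 3 1 C (seqData ψ Y ω) ν (2 ^ k) = 1})
        ≤ 7 / 3 * Real.exp (-(t * A)) := by
    intro ν hν
    have hν1 := one_le_of_mem_gridV (hfin.mem_toFinset.1 hν)
    have h1 : P.real {ω | phi μ n p 1 3 3 1 C (seqData ψ Y ω) ν p = 1} ≤ Real.exp (-(t * A)) := by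
      refine le_trans (measureReal_mono fun ω hω => ?_) (measure_total_energy_noise_le h hw hn hp hA
        (costA_le_self hμ hn hp) hν1 ht (C := C) (by linarith) fun j k => by simp)
      exact (phi_eq_one_iff_dense (not_lt.2 (sqrt_mul_costA_le hμ hn hp))).1 hω
    have h2 : P.real (⋃ k ∈ F, {ω | phi μ n p 1 3 3 1 C (seqData ψ Y ω) ν (2 ^ k) = 1})
        ≤ 4 / 3 * Real.exp (-(t * A)) := by
      refine (measureReal_biUnion_finset_le _ _).trans ?_
      calc _ ≤ ∑ k ∈ F, Real.exp (-logTerm p A (2 ^ k)) * Real.exp (-(t * A)) := by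
            refine Finset.sum_le_sum fun k hk => ?_
            have hk' : ((2 ^ k : ℕ) : ℝ) < √(p * A) := by exact_mod_cast hF k hk
            refine (measure_phi_sparse_noise_le h hw hn hp (by linarith) hC hν1 Nat.one_le_two_pow
              hk').trans ?_
            rw [← Real.exp_add, Real.exp_le_exp]
            have := half_le_logTerm Nat.one_le_two_pow hk'
            nlinarith
        _ ≤ _ := by
            rw [← Finset.sum_mul]
            exact mul_le_mul_of_nonneg_right (sum_exp_neg_logTerm_le hp hA hF) (Real.exp_pos _).le
    linarith [measureReal_union_le (μ := P) {ω | phi μ n p 1 3 3 1 C (seqData ψ Y ω) ν p = 1}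
      (⋃ k ∈ F, {ω | phi μ n p 1 3 3 1 C (seqData ψ Y ω) ν (2 ^ k) = 1})]
  refine (measureReal_mono hsub (measure_ne_top _ _)).trans
    ((measureReal_biUnion_finset_le _ _).trans
    ((Finset.sum_le_sum hν).trans ?_))
  rw [Finset.sum_const, nsmul_eq_mul, ← Set.ncard_eq_toFinset_card _ hfin]
  have hN := ncard_gridV_le hμ hn hp
  have he := Real.exp_one_gt_d9
  calc ((gridV μ n p).ncard : ℝ) * (7 / 3 * Real.exp (-(t * A)))
      ≤ Real.exp (A - 1) * (Real.exp 1 * Real.exp (-(t * A))) := by gcongr; linarith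
    _ = Real.exp (-((t - 1) * A)) := by
        rw [← Real.exp_add, ← Real.exp_add]; congr 1; ring
    _ ≤ _ := Real.exp_le_exp.2 (by nlinarith)

/-! ### Detection of separated signals -/

theorem sq_le_integral_sq_of_le_eLpNorm {f : (Fin p → I) → ℝ} (hf : MemLp f 2 volume) {c : ℝ}
    (hc : 0 ≤ c) (h : ENNReal.ofReal c ≤ eLpNorm f 2 (volume : Measure (Fin p → I))) :
    c ^ 2 ≤ ∫ x, f x ^ 2 := by
  have h1 : c ≤ ‖hf.toLp‖ := by
    rw [Lp.norm_toLp]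
    exact (ENNReal.ofReal_le_iff_le_toReal hf.eLpNorm_ne_top).1 h
  have h2 : ‖hf.toLp‖ ^ 2 = ∫ x, f x ^ 2 := by
    rw [← real_inner_self_eq_norm_sq, L2.inner_def]
    refine integral_congr_ae ?_
    filter_upwards [hf.coeFn_toLp] with x hx
    rw [hx]
    simp [sq]
  rw [← h2]
  exact pow_le_pow_left₀ hc h1 2

theorem sqrt_mul_logTerm_div_le_tauSq (s : ℕ) :
    (s : ℝ) / n * √(nuH μ n p s (costA μ n p) * logTerm p (costA μ n p) s) ≤ tauSq μ n p s := by
  unfold tauSq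
  split_ifs
  · exact le_max_right _ _
  · exact le_rfl

/-- The energy captured by the first `ν` coefficients of each signal coordinate. -/
theorem signal_energy_ge (h : IsEigensystem H μ ψ) (hn : 1 ≤ n) (hp : 1 ≤ p) {S : Finset (Fin p)}
    {g : Fin p → H} (hg : ∀ j ∈ S, ‖g j‖ ≤ 1) {s ν : ℕ} (hs1 : 1 ≤ s) (hS : S.card ≤ s)
    (hν : nuH μ n p s (costA μ n p) ≤ ν) {C : ℝ} (hC : 0 ≤ C)
    (hnorm : ENNReal.ofReal (C * tau μ n p s)
      ≤ eLpNorm (fun x : Fin p → I => ∑ j ∈ S, g j (x j)) 2 volume) :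
    (C ^ 2 - 1) * (n * tauSq μ n p s) ≤ ∑ j ∈ S, ∑ k ∈ Finset.range ν,
      (√n * ∫ x : Fin p → I, (∑ i ∈ S, g i (x i)) * ψ k (x j)) ^ 2 := by
  have hn0 : (0 : ℝ) < n := by exact_mod_cast hn
  have hA := one_le_costA (μ := μ) h.eigenvalue_le_one hn hp
  have hnu := nuH_spec (μ := μ) h.eigenvalue_le_one hn hp (show 0 < costA μ n p by linarith) hs1
  have hτ := sqrt_mul_logTerm_div_le_tauSq (μ := μ) (n := n) (p := p) s
  have hτ0 : 0 ≤ tauSq μ n p s := le_trans (by positivity) hτ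
  have h1 := sq_le_integral_sq_of_le_eLpNorm (memLp_additive h S g)
    (mul_nonneg hC (Real.sqrt_nonneg _)) hnorm
  rw [mul_pow, Real.sq_sqrt hτ0] at h1
  have h2 := sum_signal_ge h S g hg ν
  have h3 : S.card * μ ν ≤ tauSq μ n p s := by
    refine le_trans ?_ hτ
    -- Indexing from 0 makes `μ ν` the first discarded eigenvalue; monotonicity compares it with the
    -- one at `ν_H - 1`.
    have h4 : μ ν ≤ √(nuH μ n p s (costA μ n p) * logTerm p (costA μ n p) s) / n :=
      (h.antitone (by omega)).trans hnu.2
    have h5 : (S.card : ℝ) ≤ s := by exact_mod_cast hS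
    calc (S.card : ℝ) * μ ν
        ≤ s * (√(nuH μ n p s (costA μ n p) * logTerm p (costA μ n p) s) / n) :=
          mul_le_mul h5 h4 (h.nonneg ν) (Nat.cast_nonneg _)
      _ = _ := by ring
  have h6 : ∑ j ∈ S, ∑ k ∈ Finset.range ν,
      (√n * ∫ x : Fin p → I, (∑ i ∈ S, g i (x i)) * ψ k (x j)) ^ 2
      = n * ∑ j ∈ S, ∑ k ∈ Finset.range ν,
      (∫ x : Fin p → I, (∑ i ∈ S, g i (x i)) * ψ k (x j)) ^ 2 := by
    simp_rw [mul_pow, Real.sq_sqrt hn0.le, ← Finset.mul_sum]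
  rw [h6]
  have h7 : (C ^ 2 - 1) * tauSq μ n p s ≤ ∑ j ∈ S, ∑ k ∈ Finset.range ν,
      (∫ x : Fin p → I, (∑ i ∈ S, g i (x i)) * ψ k (x j)) ^ 2 := by linarith
  calc _ = n * ((C ^ 2 - 1) * tauSq μ n p s) := by ring
    _ ≤ _ := mul_le_mul_of_nonneg_left h7 hn0.le

theorem measure_energy_le_le (h : IsEigensystem H μ ψ) (hw : IsWhiteNoise n f P Y) (hn : 1 ≤ n)
    (S : Finset (Fin p)) (ν : ℕ) {M : ℝ} (hM : M = ∑ j ∈ S, ∑ k ∈ Finset.range ν,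
      (√n * ∫ x : Fin p → I, f x * ψ k (x j)) ^ 2) (hM0 : 0 < M) :
    P.real {ω | ∑ j ∈ S, energy n (seqData ψ Y ω) ν j ≤ S.card * ν + M / 2}
      ≤ 32 / M + 648 * (S.card * ν) / M ^ 2 := by
  have := hw.gaussian.isProbabilityMeasure
  have hM' : M = ∑ a ∈ S ×ˢ Finset.range ν,
      (√n * ∫ x : Fin p → I, f x * ψ a.2 (x a.1)) ^ 2 := by
    rw [hM, Finset.sum_product]
  have key := measure_sum_sq_le_le (iIndepFun_normData h hw hn) (S ×ˢ Finset.range ν)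
    (fun a _ => hasLaw_normData h hw hn a) (hM' ▸ hM0)
  rw [← hM', Finset.card_product, Finset.card_range] at key
  push_cast at key
  refine le_trans (measureReal_mono fun ω hω => ?_) key
  simp only [Set.mem_ofPred_eq] at hω ⊢
  rw [Finset.sum_product]
  refine le_trans (le_of_eq (Finset.sum_congr rfl fun j _ => ?_)) hω
  rw [← sum_normData_sq, Fin.sum_univ_eq_sum_range (fun k => normData n ψ Y j k ω ^ 2)]

theorem logTerm_le_four_mul {A : ℝ} (hA : 0 ≤ A) {r s : ℕ} (hr : 1 ≤ r) (hs : 1 ≤ s)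
    (hsr : s ≤ 2 * r) : logTerm p A r ≤ 4 * logTerm p A s := by
  have hr0 : (0 : ℝ) < r := by exact_mod_cast hr
  have hs0 : (0 : ℝ) < s := by exact_mod_cast hs
  have hsr' : (s : ℝ) ≤ 2 * r := by exact_mod_cast hsr
  have e : (4 : ℝ) * logTerm p A s = ((4 : ℕ) : ℝ) * logTerm p A s := by norm_num
  rw [e, logTerm, logTerm, ← Real.log_pow]
  refine Real.log_le_log (by positivity) ?_
  have h1 := one_add_mul_le_pow (show (-2 : ℝ) ≤ p * A / (s : ℝ) ^ 2 by
    linarith [show 0 ≤ p * A / (s : ℝ) ^ 2 by positivity]) 4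
  refine le_trans ?_ h1
  have h2 : p * A / (r : ℝ) ^ 2 ≤ 4 * (p * A / (s : ℝ) ^ 2) := by
    rw [mul_div_assoc', div_le_div_iff₀ (by positivity) (by positivity)]
    have : (s : ℝ) ^ 2 ≤ 4 * (r : ℝ) ^ 2 := by nlinarith
    nlinarith [mul_le_mul_of_nonneg_left this (show 0 ≤ p * A by positivity)]
  push_cast
  linarith

/-- Passing to the grid costs a factor 2 in `ν` and 4 in the logarithm, hence at most `√8 ≤ 4` in
the scale. -/
theorem mul_thrScale_le_tauSq (hn : 1 ≤ n) (hA : 0 ≤ costA μ n p) {r s ν : ℕ} (hr : 1 ≤ r)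
    (hrs : r ≤ s) (hsr : s ≤ 2 * r) (hs : (s : ℝ) < √(p * costA μ n p))
    (hν : ν ≤ 2 * nuH μ n p s (costA μ n p)) :
    r * thrScale ν (logTerm p (costA μ n p) r) / 4 ≤ n * tauSq μ n p s := by
  have hn0 : (0 : ℝ) < n := by exact_mod_cast hn
  have hs0 : (0 : ℝ) < s := by exact_mod_cast hr.trans hrs
  have hrs' : (r : ℝ) ≤ s := by exact_mod_cast hrs
  have hLL := logTerm_le_four_mul (p := p) hA hr (hr.trans hrs) hsr
  have hLs := half_le_logTerm (hr.trans hrs) hs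
  have hL := half_le_logTerm hr ((Nat.cast_le.2 hrs).trans_lt hs)
  have e : n * tauSq μ n p s = s * max (logTerm p (costA μ n p) s)
      √(nuH μ n p s (costA μ n p) * logTerm p (costA μ n p) s) := by
    rw [tauSq, if_pos hs, ← mul_max_of_nonneg _ _ (by positivity), ← mul_assoc,
      mul_div_cancel₀ _ hn0.ne']
  rw [e]
  generalize logTerm p (costA μ n p) r = L at *
  generalize logTerm p (costA μ n p) s = Ls at *
  have h3 : (ν : ℝ) ≤ 2 * nuH μ n p s (costA μ n p) := by exact_mod_cast hν
  generalize (nuH μ n p s (costA μ n p) : ℝ) = N at *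
  have hN : 0 ≤ N := by linarith [Nat.cast_nonneg (α := ℝ) ν]
  have h1 : L ≤ 4 * max Ls √(N * Ls) :=
    hLL.trans (mul_le_mul_of_nonneg_left (le_max_left _ _) (by norm_num))
  have h2 : √(ν * L) ≤ 4 * max Ls √(N * Ls) := by
    refine le_trans ?_ (mul_le_mul_of_nonneg_left (le_max_right _ _) (by norm_num))
    rw [Real.sqrt_le_left (by positivity), mul_pow, Real.sq_sqrt (by positivity)]
    have h4 : (ν : ℝ) * L ≤ (2 * N) * (4 * Ls) :=
      mul_le_mul h3 hLL (by linarith) (by positivity)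
    nlinarith [show 0 ≤ N * Ls by positivity]
  have h5 : thrScale ν L ≤ 4 * max Ls √(N * Ls) := max_le h2 h1
  calc r * thrScale ν L / 4 ≤ s * (4 * max Ls √(N * Ls)) / 4 := by
        have := thrScale_pos (d := ν) hL
        gcongr
    _ = _ := by ring

theorem chebyshev_bound_le {B M x c : ℝ} (hB : 1 ≤ B) (hx : 1 / 2 ≤ x) (hc : c ≤ 4 * x ^ 2)
    (hM : B * x / 4 ≤ M) : 32 / M + 648 * c / M ^ 2 ≤ 42000 / B := by
  have hx0 : 0 < x := by linarith
  have hB0 : 0 < B := by linarith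
  have hBx : 0 < B * x / 4 := by positivity
  have hM0 : 0 < M := hBx.trans_le hM
  have h2 : 32 / M ≤ 256 / B := by
    rw [div_le_div_iff₀ hM0 hB0]
    nlinarith
  have h3 : 648 * c / M ^ 2 ≤ 41472 / B := by
    calc 648 * c / M ^ 2
        ≤ 648 * (4 * x ^ 2) / (B * x / 4) ^ 2 := by gcongr
      _ = 41472 / B ^ 2 := by field_simp; norm_num
      _ ≤ 41472 / B := by
          gcongr
          nlinarith
  calc _ ≤ 256 / B + 41472 / B := add_le_add h2 h3
    _ = 41728 / B := by ring
    _ ≤ _ := by gcongr; norm_num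

/-- Deterministic balance, with `q` the scale: `M / 2 ≥ (2C + 42) r q`. The 42 pays for thresholding
at most `2r` signal coordinates at `21q` each; one `C` offsets the noise and the other is the
critical value. -/
theorem lt_sum_thresh {d : ℕ} (hd : 1 ≤ d) {L : ℝ} (hL : 1 / 2 ≤ L) (e : Fin p → ℝ)
    {S : Finset (Fin p)} {r : ℕ} {B C M : ℝ} (hS : S.card ≤ 2 * r)
    (hBC : 16 * C + 336 ≤ B) (hM : B * (r * thrScale d L) / 4 ≤ M)
    (hnoise : -1 * ∑ j ∈ Sᶜ, thresh (Fin d) (d + 9 * thrScale d L) (e j) < C * r * thrScale d L)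
    (hsignal : S.card * d + M / 2 < ∑ j ∈ S, e j) :
    C * r * thrScale d L < ∑ j, thresh (Fin d) (d + 9 * thrScale d L) (e j) := by
  have hq := thrScale_pos (d := d) hL
  have h1 : ∑ j ∈ S, (e j - (d + 21 * thrScale d L))
      ≤ ∑ j ∈ S, thresh (Fin d) (d + 9 * thrScale d L) (e j) :=
    Finset.sum_le_sum fun j _ => sub_condMean_le_thresh hd hL _
  rw [Finset.sum_sub_distrib, Finset.sum_const, nsmul_eq_mul] at h1
  rw [← Finset.sum_add_sum_compl S]
  have hS' : (S.card : ℝ) ≤ 2 * r := by exact_mod_cast hS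
  generalize thrScale d L = q at *
  have h2 : (S.card : ℝ) * (21 * q) ≤ 2 * r * (21 * q) := by gcongr
  have h3 : (16 * C + 336) * (r * q) ≤ B * (r * q) :=
    mul_le_mul_of_nonneg_right hBC (by positivity)
  linarith

/-- The scan detects signals of low sparsity. -/
theorem measure_scanTest_sparse_le (h : IsEigensystem H μ ψ) (hn : 1 ≤ n) (hp : 1 ≤ p)
    {S : Finset (Fin p)} {g : Fin p → H}
    (hw : IsWhiteNoise n (fun x => ∑ j ∈ S, g j (x j)) P Y) (hg : ∀ j ∈ S, ‖g j‖ ≤ 1)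
    {s : ℕ} (hs1 : 1 ≤ s) (hsp : s ≤ p) (hS : S.card ≤ s)
    (hs : (s : ℝ) < √(p * costA μ n p)) {C t : ℝ} (ht : 0 ≤ t) (hC : 300 + 48 * t ≤ C)
    (hnorm : ENNReal.ofReal (C * tau μ n p s)
      ≤ eLpNorm (fun x : Fin p → I => ∑ j ∈ S, g j (x j)) 2 volume) :
    P.real {ω | scanTest μ n p 1 3 3 1 C (seqData ψ Y ω) ≠ 1}
      ≤ Real.exp (-t) + 42000 / (C ^ 2 - 1) := by
  have := hw.gaussian.isProbabilityMeasure
  have hμ := h.eigenvalue_le_one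
  obtain ⟨ν, hνV, hν1, hν2⟩ := exists_mem_gridV hμ hn hp hs1 hsp
  obtain ⟨r, hrS, hr1, hrs, hsr⟩ := exists_mem_gridS hμ hn hp hs1 hs
  have hνpos := one_le_of_mem_gridV hνV
  have hsig := signal_energy_ge h hn hp hg hs1 hS hν1 (C := C) (by linarith) hnorm
  obtain ⟨M, hM⟩ : ∃ M, M = ∑ j ∈ S, ∑ k ∈ Finset.range ν,
      (√n * ∫ x : Fin p → I, (∑ i ∈ S, g i (x i)) * ψ k (x j)) ^ 2 := ⟨_, rfl⟩
  rw [← hM] at hsig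
  have hA : 1 ≤ costA μ n p := one_le_costA hμ hn hp
  have hr0 : (1 : ℝ) ≤ r := by exact_mod_cast hr1
  have hr : (r : ℝ) < √(p * costA μ n p) := (Nat.cast_le.2 hrs).trans_lt hs
  have hL := half_le_logTerm hr1 hr
  have hτ := mul_thrScale_le_tauSq hn (by linarith) hr1 hrs hsr hs hν2
  have hnoise := measure_sum_thresh_noise_le h hw hn hp hA (costA_le hμ hn hp) hr1 hr hνpos ht hC
    (J := Sᶜ) (ε := -1) (fun j hj k => by
      rw [integral_additive_mul h S g (h.memLp k), if_neg (Finset.mem_compl.1 hj)]) (by simp)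
  have hphi := fun X : ℕ → Fin p → ℝ =>
    phi_eq_one_iff_sparse (C := C) (X := X) hνpos (by linarith) hr
  generalize logTerm p (costA μ n p) r = L at *
  -- Here the energy, quadratic in `C`, overtakes the critical value, linear in `C`.
  have hBC : 16 * C + 336 ≤ C ^ 2 - 1 := by nlinarith
  have hq0 : 0 < thrScale ν L := thrScale_pos hL
  have hqL : L ≤ thrScale ν L := le_thrScale
  have hMq : (C ^ 2 - 1) * (r * thrScale ν L) / 4 ≤ M := by
    refine le_trans ?_ hsig
    rw [mul_div_assoc]
    exact mul_le_mul_of_nonneg_left hτ (by linarith)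
  have hrq : 1 / 2 ≤ r * thrScale ν L := by nlinarith
  have hM0 : 0 < M := by
    refine lt_of_lt_of_le ?_ hMq
    have := mul_pos (show 0 < C ^ 2 - 1 by linarith) (show 0 < r * thrScale ν L by linarith)
    linarith
  have hcard : S.card ≤ 2 * r := hS.trans hsr
  have hcard' : (S.card : ℝ) * ν ≤ 4 * (r * thrScale ν L) ^ 2 := by
    have h1 : (S.card : ℝ) ≤ 2 * r := by exact_mod_cast hcard
    calc (S.card : ℝ) * ν ≤ (2 * r) * (2 * thrScale ν L ^ 2) := by
          gcongr
          exact card_le_thrScale_sq hL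
      _ = 4 * r * thrScale ν L ^ 2 := by ring
      _ ≤ 4 * (r * r) * thrScale ν L ^ 2 := by
          have : (r : ℝ) ≤ r * r := le_mul_of_one_le_left (by linarith) hr0
          gcongr
      _ = _ := by ring
  have hsignal := (measure_energy_le_le h hw hn S ν hM hM0).trans
    (chebyshev_bound_le (by linarith) hrq hcard' hMq)
  refine (measureReal_mono (s₂ := _ ∪ _) (fun ω hω => ?_) (measure_ne_top _ _)).trans
    ((measureReal_union_le _ _).trans (add_le_add (hnoise.trans (Real.exp_le_exp.2 ?_)) hsignal))
  · by_contra hc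
    simp only [Set.mem_union, Set.mem_ofPred_eq, not_or, not_le] at hc
    exact hω (scanTest_eq_one_iff.2 ⟨ν, hνV, r, hrS,
      (hphi _).2 (lt_sum_thresh hνpos hL _ hcard hBC hMq hc.1 hc.2)⟩)
  · nlinarith

/-- The scan detects signals of high sparsity. -/
theorem measure_scanTest_dense_le (h : IsEigensystem H μ ψ) (hn : 1 ≤ n) (hp : 1 ≤ p)
    {S : Finset (Fin p)} {g : Fin p → H}
    (hw : IsWhiteNoise n (fun x => ∑ j ∈ S, g j (x j)) P Y) (hg : ∀ j ∈ S, ‖g j‖ ≤ 1)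
    {s : ℕ} (hs1 : 1 ≤ s) (hsp : s ≤ p) (hS : S.card ≤ s)
    (hs : ¬ (s : ℝ) < √(p * costA μ n p)) {C : ℝ} (hC : 300 ≤ C)
    (hnorm : ENNReal.ofReal (C * tau μ n p s)
      ≤ eLpNorm (fun x : Fin p → I => ∑ j ∈ S, g j (x j)) 2 volume) :
    P.real {ω | scanTest μ n p 1 3 3 1 C (seqData ψ Y ω) ≠ 1} ≤ 42000 / (C ^ 2 - 1) := by
  have := hw.gaussian.isProbabilityMeasure
  have hμ := h.eigenvalue_le_one
  have hn0 : (0 : ℝ) < n := by exact_mod_cast hn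
  obtain ⟨ν, hνV, hν1, hν2⟩ := exists_mem_gridV hμ hn hp hs1 hsp
  have hνpos := one_le_of_mem_gridV hνV
  have hsig := signal_energy_ge h hn hp hg hs1 hS hν1 (C := C) (by linarith) hnorm
  set A := costA μ n p with hAdef
  have hA : 1 ≤ A := one_le_costA hμ hn hp
  have hs0 : (0 : ℝ) < s := by exact_mod_cast hs1
  have hp1 : (1 : ℝ) ≤ p := by exact_mod_cast hp
  have hν0 : (1 : ℝ) ≤ ν := by exact_mod_cast hνpos
  set B := C ^ 2 - 1 with hB
  have hBC : 16 * C ≤ B := by nlinarith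
  have hB0 : 1 ≤ B := by linarith
  have hτ : √(ν * p * A) / 2 ≤ n * tauSq μ n p s := by
    have e : n * tauSq μ n p s = s * √(nuH μ n p s A * logTerm p A s) := by
      rw [tauSq, if_neg hs, ← mul_assoc, mul_div_cancel₀ _ hn0.ne']
    have hu : p * A ≤ (s : ℝ) ^ 2 := by
      have := not_lt.1 hs
      rwa [Real.sqrt_le_left hs0.le] at this
    -- Use `log (1 + x) ≥ x / (1 + x) ≥ x / 2` at `x = pA / s² ≤ 1`.
    have hlog : p * A / 2 ≤ (s : ℝ) ^ 2 * logTerm p A s := by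
      have hx : 0 < p * A / (s : ℝ) ^ 2 := by positivity
      have h1 := Real.one_sub_inv_le_log_of_pos (show 0 < 1 + p * A / (s : ℝ) ^ 2 by linarith)
      have h2 : 1 - (1 + p * A / (s : ℝ) ^ 2)⁻¹ = p * A / ((s : ℝ) ^ 2 + p * A) := by
        field_simp
        ring
      rw [h2] at h1
      have h3 : p * A / (2 * (s : ℝ) ^ 2) ≤ p * A / ((s : ℝ) ^ 2 + p * A) := by
        gcongr
        linarith
      calc p * A / 2 = (s : ℝ) ^ 2 * (p * A / (2 * (s : ℝ) ^ 2)) := by field_simp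
        _ ≤ _ := mul_le_mul_of_nonneg_left (h3.trans h1) (by positivity)
    rw [e, div_le_iff₀ two_pos, Real.sqrt_le_left (by positivity)]
    have hlog0 := logTerm_pos (s := s) hp (show 0 < A by linarith) hs1
    rw [mul_pow, mul_pow, Real.sq_sqrt (by positivity)]
    have h3 : (ν : ℝ) ≤ 2 * nuH μ n p s A := by exact_mod_cast hν2
    have h4 : (ν : ℝ) * (p * A / 2) ≤ (2 * nuH μ n p s A) * ((s : ℝ) ^ 2 * logTerm p A s) :=
      mul_le_mul h3 hlog (by positivity) (by positivity)
    nlinarith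
  set M := ∑ j : Fin p, ∑ k ∈ Finset.range ν,
      (√n * ∫ x : Fin p → I, (∑ i ∈ S, g i (x i)) * ψ k (x j)) ^ 2 with hM
  have hMq : B * √(ν * p * A) / 2 ≤ M := by
    have h1 : ∑ j ∈ S, ∑ k ∈ Finset.range ν,
      (√n * ∫ x : Fin p → I, (∑ i ∈ S, g i (x i)) * ψ k (x j)) ^ 2 ≤ M :=
      Finset.sum_le_sum_of_subset_of_nonneg (Finset.subset_univ S) fun _ _ _ =>
        Finset.sum_nonneg fun _ _ => sq_nonneg _
    refine le_trans ?_ (hsig.trans h1)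
    nlinarith
  have hR2 := Real.sq_sqrt (show 0 ≤ ν * p * A by positivity)
  have hνp : (ν : ℝ) * p ≤ √(ν * p * A) ^ 2 := by
    rw [hR2]
    exact le_mul_of_one_le_right (by positivity) hA
  have hR1 : 1 ≤ √(ν * p * A) := by
    rw [Real.one_le_sqrt]
    nlinarith
  set R := √(ν * p * A) with hRdef
  have hM0 : 0 < M := lt_of_lt_of_le (by positivity) hMq
  have hsignal := measure_energy_le_le h hw hn Finset.univ ν hM hM0
  rw [Finset.card_univ, Fintype.card_fin] at hsignal
  have hsub : {ω | scanTest μ n p 1 3 3 1 C (seqData ψ Y ω) ≠ 1}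
      ⊆ {ω | ∑ j, energy n (seqData ψ Y ω) ν j ≤ p * ν + M / 2} := by
    intro ω hω
    by_contra hc
    simp only [Set.mem_ofPred_eq, not_le] at hc
    refine hω (scanTest_eq_one_iff.2 ⟨ν, hνV, p, (mem_gridS_iff hμ hn hp).2 (Or.inr rfl), ?_⟩)
    refine (phi_eq_one_iff_dense (not_lt.2 (sqrt_mul_costA_le hμ hn hp))).2 ?_
    change ν * p + C * R < _
    have : 16 * C * R ≤ B * R := mul_le_mul_of_nonneg_right hBC (by linarith)
    have : 0 ≤ C * R := mul_nonneg (by linarith) (by linarith)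
    linarith
  refine (measureReal_mono hsub).trans (hsignal.trans ?_)
  have h2 : 32 / M ≤ 64 / B := by
    rw [div_le_div_iff₀ hM0 (by linarith)]
    nlinarith
  have h3 : 648 * (p * ν) / M ^ 2 ≤ 2592 / B := by
    calc 648 * (p * ν) / M ^ 2 ≤ 648 * R ^ 2 / (B * R / 2) ^ 2 := by
          gcongr
          linarith
      _ = 2592 / B ^ 2 := by field_simp; norm_num
      _ ≤ 2592 / B := by
          gcongr
          nlinarith
  calc _ ≤ 64 / B + 2592 / B := add_le_add h2 h3
    _ = 2656 / B := by ring
    _ ≤ _ := by gcongr; norm_num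

end

end SparseAdditive

theorem mainTheorem6 :
    ∃ D K₂ K₂' K₃ : ℝ, 0 < D ∧ 0 < K₂ ∧ 0 < K₂' ∧ 0 < K₃ ∧
    ∀ η : ℝ, 0 < η → η < 1 → ∃ Cη : ℝ, 0 < Cη ∧ ∀ C : ℝ, Cη < C →
    ∀ (n p : ℕ), 1 ≤ n → 1 ≤ p →
    ∀ (H : Type*) [NormedAddCommGroup H] [InnerProductSpace ℝ H] [CompleteSpace H]
      [RKHS ℝ H I ℝ] (μ : ℕ → ℝ) (ψ : ℕ → I → ℝ), SparseAdditive.IsEigensystem H μ ψ →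
    ∀ (Ω : Type*) [MeasurableSpace Ω] (Y : ((Fin p → I) → ℝ) → Ω → ℝ)
      (P : ((Fin p → I) → ℝ) → Measure Ω),
      (∀ f ∈ SparseAdditive.sparseClass H p p, SparseAdditive.IsWhiteNoise n f (P f) Y) →
    P 0 {ω | SparseAdditive.scanTest μ n p D K₂ K₂' K₃ C (SparseAdditive.seqData ψ Y ω) ≠ 0}
      + ⨆ s ∈ Set.Icc 1 p, ⨆ f ∈ SparseAdditive.sparseClass H p s,
          ⨆ _ : ENNReal.ofReal (C * SparseAdditive.tau μ n p s)
              ≤ eLpNorm f 2 (volume : Measure (Fin p → I)),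
            P f {ω | SparseAdditive.scanTest μ n p D K₂ K₂' K₃ C
              (SparseAdditive.seqData ψ Y ω) ≠ 1}
      ≤ ENNReal.ofReal η := by
  refine ⟨1, 3, 3, 1, by norm_num, by norm_num, by norm_num, by norm_num, fun η hη hη1 => ?_⟩
  -- This makes the null error `exp (-(t - 1))` equal to `η / 2`. The other half of `η` is split
  -- between the noise deviation `exp (-t)` and the Chebyshev term, for which `C > 168000 / η`
  -- provides.
  obtain ⟨t, ht⟩ : ∃ t, t = 1 + Real.log (2 / η) := ⟨_, rfl⟩
  have hlog : 0 < Real.log (2 / η) := Real.log_pos (by rw [lt_div_iff₀ hη]; linarith)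
  have hη0 : 0 < 168000 / η := by positivity
  refine ⟨300 + 48 * t + 168000 / η, by linarith, fun C hC => ?_⟩
  intro n p hn hp H _ _ _ _ μ ψ h Ω _ Y P hP
  have hexp : Real.exp (-(t - 1)) = η / 2 := by
    rw [ht, add_sub_cancel_left, ← Real.log_inv, Real.exp_log (by positivity), inv_div]
  have hexp' : Real.exp (-t) ≤ η / 4 := by
    have h1 : Real.exp (-t) * Real.exp 1 = η / 2 := by
      rw [← Real.exp_add, ← hexp]; congr 1; ring
    have := Real.exp_one_gt_d9
    nlinarith [Real.exp_pos (-t)]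
  have hcheb : 42000 / (C ^ 2 - 1) ≤ η / 4 := by
    have h1 : 168000 / η ≤ C ^ 2 - 1 := by nlinarith
    rw [div_le_iff₀ hη] at h1
    rw [div_le_iff₀ (by nlinarith)]
    linarith
  have hreal : ∀ {Q : Measure Ω} {s : Set Ω}, IsProbabilityMeasure Q → Q.real s ≤ η / 2 →
      Q s ≤ ENNReal.ofReal (η / 2) := fun {Q s} _ hs => by
    rw [← ofReal_measureReal]
    exact ENNReal.ofReal_le_ofReal hs
  have h0 : (0 : (Fin p → I) → ℝ) ∈ SparseAdditive.sparseClass H p p :=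
    ⟨∅, by simp, 0, by simp, by ext; simp⟩
  rw [← add_halves η, ENNReal.ofReal_add (by positivity) (by positivity)]
  refine add_le_add ?_ (iSup₂_le fun s hs => iSup₂_le fun f hf => iSup_le fun hnorm => ?_)
  · refine hreal (hP 0 h0).gaussian.isProbabilityMeasure (hexp ▸ ?_)
    exact SparseAdditive.measure_scanTest_noise_le h (hP 0 h0) hn hp (by linarith) (by linarith)
  · obtain ⟨S, hS, g, hg, rfl⟩ := hf
    have hw := hP _ ⟨S, hS.trans hs.2, g, hg, rfl⟩
    refine hreal hw.gaussian.isProbabilityMeasure ?_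
    by_cases hsA : (s : ℝ) < √(p * SparseAdditive.costA μ n p)
    · linarith [SparseAdditive.measure_scanTest_sparse_le h hn hp hw hg hs.1 hs.2 hS hsA
        (t := t) (C := C) (by linarith) (by linarith) hnorm]
    · linarith [SparseAdditive.measure_scanTest_dense_le h hn hp hw hg hs.1 hs.2 hS hsA
        (C := C) (by linarith) hnorm]
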